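/- Let $\mathcal A$ be a Grothendieck category. A nonzero object $H$ is monoform if for every nonzero subobject $N\subseteq H$ the objects $H$ and $H/N$ have no nonzero subobject in common (up to isomorphism). An atom is an equivalence class $\overline H$ of monoform objects, two being equivalent if they have a common nonzero subobject; $\mathrm{ASpec}\,\mathcal A$ is the collection of atoms. For an object $M$ let $\mathrm{ASupp}\,M$ be the set of atoms $\overline H$ with $H$ a monoform subquotient of $M$, and for a full subcategory $\mathcal X$ put $\mathrm{ASupp}\,\mathcal X=\bigcup_{M\in\mathcal X}\mathrm{ASupp}\,M$. A set $\Phi$ of atoms is open if every $\alpha\in\Phi$ is $\overline H$ for some monoform $H$ with $\mathrm{ASupp}\,H\subseteq\Phi$; write $\alpha\le\beta$ if every open set containing $\alpha$ contains $\beta$. A Serre subcategory $\mathcal X$ is localizing if the canonical functor $\mathcal A\to\mathcal A/\mathcal X$ has a right adjoint. The Gabriel–Krull filtration is defined as follows: $\mathcal A_{-1}$ is the zero subcategory; $\mathcal A_0$ is the smallest localizing subcategory containing all simple objects; $\mathcal A_{\rho+1}$ consists of the objects whose image in $\mathcal A/\mathcal A_\rho$ lies in $(\mathcal A/\mathcal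 A_\rho)_0$; and for a limit ordinal $\sigma$, $\mathcal A_\sigma$ is the smallest localizing subcategory containing all $\mathcal A_\rho$ with $\rho<\sigma$. The Gabriel–Krull dimension $\mathrm{GKdim}\,M$ is the least $\sigma$ (equal to $-1$ or an ordinal) with $M\in\mathcal A_\sigma$, if there is one. The dimension $\dim M$ is the largest ordinal $\sigma$, if it exists, for which there is a strict chain of atoms $\alpha_0<\alpha_1<\dots<\alpha_\sigma$ in $\mathrm{ASupp}\,M$ (indexed by the ordinals $\le\sigma$) with $\alpha_0\in\mathrm{ASupp}\,\mathcal A_\sigma\setminus\mathrm{ASupp}\,\mathcal A_{\sigma_1}$, where $\sigma=\sigma_1+1$ (and $\sigma_1=-1$ if $\sigma=0$). **Theorem.** Let $M$ be an object of $\mathcal A$ such that $\dim M$ exists. If $\mathrm{GKdim}\,M$ exists, then $\dim M\le\mathrm{GKdim}\,M$. If moreover $\mathcal A$ is locally noetherian (it has a small generating set of noetherian objects) and the topological space $\mathrm{ASpec}\,\mathcal A$ is Alexandroff (arbitrary intersections of open sets are open), then $\mathrm{GKdim}\,M$ exists and $\dim M=\mathrm{GKdim}\,M$. -/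

import Mathlib

open CategoryTheory CategoryTheory.Limits

universe w v u

namespace AtomDimension

section Atoms

variable {C : Type u} [Category.{v} C]

/-- `X` and `Y` have a common nonzero subobject: some nonzero object is isomorphic both to
a subobject of `X` and to a subobject of `Y`. -/
def CommonNonzeroSubobject (X Y : C) : Prop :=
  ∃ L : C, ¬ IsZero L ∧ (∃ f : L ⟶ X, Mono f) ∧ (∃ g : L ⟶ Y, Mono g)

theorem CommonNonzeroSubobject.refl {X : C} (h : ¬ IsZero X) : CommonNonzeroSubobject X X :=
  ⟨X, h, ⟨𝟙 X, inferInstance⟩, ⟨𝟙 X, inferInstance⟩⟩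

theorem CommonNonzeroSubobject.symm {X Y : C} (h : CommonNonzeroSubobject X Y) :
    CommonNonzeroSubobject Y X := by
  obtain ⟨L, hL, hf, hg⟩ := h
  exact ⟨L, hL, hg, hf⟩

variable [Abelian C]

/-- An object `M` is monoform if it is nonzero and, for every nonzero subobject `N` of `M`,
the objects `M` and `M / N` have no common nonzero subobject. -/
def IsMonoform (M : C) : Prop :=
  ¬ IsZero M ∧ ∀ (N : C) (i : N ⟶ M) [Mono i], ¬ IsZero N →
    ¬ CommonNonzeroSubobject M (cokernel i)

theorem IsMonoform.not_isZero_pullback {H L₁ L₂ : C} (hH : IsMonoform H)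
    (f₁ : L₁ ⟶ H) (f₂ : L₂ ⟶ H) [Mono f₁] [Mono f₂]
    (h₁ : ¬ IsZero L₁) (h₂ : ¬ IsZero L₂) : ¬ IsZero (pullback f₁ f₂) := by
  intro hz
  refine hH.2 L₂ f₂ h₂ ⟨L₁, h₁, ⟨f₁, inferInstance⟩, ⟨f₁ ≫ cokernel.π f₂, ?_⟩⟩
  refine Preadditive.mono_of_cancel_zero _ fun {T} g hg => ?_
  have hg' : (g ≫ f₁) ≫ cokernel.π f₂ = 0 := by simpa using hg
  have e : Abelian.monoLift f₂ (g ≫ f₁) hg' ≫ f₂ = g ≫ f₁ := Abelian.monoLift_comp _ _ _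
  have : g = pullback.lift g (Abelian.monoLift f₂ (g ≫ f₁) hg') e.symm ≫ pullback.fst f₁ f₂ :=
    (pullback.lift_fst _ _ _).symm
  rw [this, hz.eq_zero_of_tgt (pullback.lift g _ e.symm), zero_comp]

theorem IsMonoform.of_mono {H L : C} (hH : IsMonoform H) (j : L ⟶ H) [Mono j]
    (hL : ¬ IsZero L) : IsMonoform L := by
  refine ⟨hL, fun N i _ hN => ?_⟩
  rintro ⟨K, hK, ⟨f, _⟩, ⟨g, _⟩⟩
  refine hH.2 N (i ≫ j) hN ⟨K, hK, ⟨f ≫ j, inferInstance⟩, ?_⟩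
  have sq : IsPullback i (𝟙 N) j (i ≫ j) := by
    refine IsPullback.of_isLimit' ⟨by simp⟩ (PullbackCone.IsLimit.mk _ (fun s => s.snd) ?_ ?_ ?_)
    · intro s
      rw [← cancel_mono j, Category.assoc, s.condition]
    · intro s
      simp
    · intro s m _ h
      simpa using h
  have : Mono (cokernel.map i (i ≫ j) (𝟙 N) j sq.w) :=
    Abelian.mono_cokernel_map_of_isPullback sq
  exact ⟨g ≫ cokernel.map i (i ≫ j) (𝟙 N) j sq.w, inferInstance⟩

theorem CommonNonzeroSubobject.trans {X Y Z : C} (hY : IsMonoform Y)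
    (h : CommonNonzeroSubobject X Y) (h' : CommonNonzeroSubobject Y Z) :
    CommonNonzeroSubobject X Z := by
  obtain ⟨L, hL, ⟨f, _⟩, ⟨g, _⟩⟩ := h
  obtain ⟨L', hL', ⟨f', _⟩, ⟨g', _⟩⟩ := h'
  exact ⟨pullback g f', hY.not_isZero_pullback g f' hL hL',
    ⟨pullback.fst g f' ≫ f, inferInstance⟩, ⟨pullback.snd g f' ≫ g', inferInstance⟩⟩

variable (C) in
/-- Monoform objects, with atom-equivalence: having a common nonzero subobject. -/
instance atomSetoid : Setoid {H : C // IsMonoform H} where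
  r H H' := CommonNonzeroSubobject H.1 H'.1
  iseqv :=
    { refl := fun H => CommonNonzeroSubobject.refl H.2.1
      symm := fun h => h.symm
      trans := fun {_ K _} h h' => CommonNonzeroSubobject.trans K.2 h h' }

variable (C) in
/-- The atom spectrum: monoform objects modulo atom-equivalence. -/
def ASpec : Type u := Quotient (atomSetoid C)

/-- The atom represented by a monoform object. -/
def atomOf (H : C) (hH : IsMonoform H) : ASpec C := Quotient.mk (atomSetoid C) ⟨H, hH⟩

/-- `H` is a subquotient of `M`: a quotient of a subobject of `M`. -/
def IsSubquotient (H M : C) : Prop :=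
  ∃ (N : C) (i : N ⟶ M) (p : N ⟶ H), Mono i ∧ Epi p

/-- The atom support of `M`: the atoms represented by a monoform subquotient of `M`. -/
def ASupp (M : C) : Set (ASpec C) :=
  {α | ∃ (H : C) (hH : IsMonoform H), atomOf H hH = α ∧ IsSubquotient H M}

/-- The atom support of a full subcategory: the union of the supports of its objects. -/
def ASuppOf (P : ObjectProperty C) : Set (ASpec C) :=
  {α | ∃ M : C, P M ∧ α ∈ ASupp M}

theorem ASupp_subset_of_mono {L M : C} (j : L ⟶ M) [Mono j] : ASupp L ⊆ ASupp M := by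
  rintro α ⟨H, hH, rfl, N, i, p, _, hp⟩
  exact ⟨H, hH, rfl, N, i ≫ j, p, inferInstance, hp⟩

/-- A set `Φ` of atoms is open if every `α ∈ Φ` is represented by a monoform object `H`
with `ASupp H ⊆ Φ`. -/
instance : TopologicalSpace (ASpec C) where
  IsOpen Φ := ∀ α ∈ Φ, ∃ (H : C) (hH : IsMonoform H), atomOf H hH = α ∧ ASupp H ⊆ Φ
  isOpen_univ := by
    rintro ⟨H, hH⟩ -
    exact ⟨H, hH, rfl, Set.subset_univ _⟩
  isOpen_inter := by
    rintro Φ Ψ hΦ hΨ α ⟨h₁, h₂⟩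
    obtain ⟨H₁, hH₁, e₁, s₁⟩ := hΦ α h₁
    obtain ⟨H₂, hH₂, e₂, s₂⟩ := hΨ α h₂
    obtain ⟨L, hL, ⟨f, _⟩, ⟨g, _⟩⟩ : CommonNonzeroSubobject H₁ H₂ :=
      Quotient.exact (e₁.trans e₂.symm)
    refine ⟨L, hH₁.of_mono f hL, ?_, fun β hβ =>
      ⟨s₁ (ASupp_subset_of_mono f hβ), s₂ (ASupp_subset_of_mono g hβ)⟩⟩
    rw [← e₁]
    exact Quotient.sound ⟨L, hL, ⟨𝟙 L, inferInstance⟩, ⟨f, inferInstance⟩⟩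
  isOpen_sUnion := by
    rintro S hS α ⟨Φ, hΦ, hα⟩
    obtain ⟨H, hH, e, s⟩ := hS Φ hΦ α hα
    exact ⟨H, hH, e, s.trans (Set.subset_sUnion_of_mem hΦ)⟩

/-- The specialization order on atoms: `α ≤ β` if every open set containing `α` contains `β`.
(The induced strict relation `α < β` means `α ≤ β` and not `β ≤ α`.) -/
instance : Preorder (ASpec C) where
  le α β := ∀ Φ : Set (ASpec C), IsOpen Φ → α ∈ Φ → β ∈ Φ
  le_refl _ _ _ h := h
  le_trans _ _ _ h h' Φ hΦ hα := h' Φ hΦ (h Φ hΦ hα)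

end Atoms

section Localizing

variable {C : Type u} [Category.{v} C] [Abelian C]

/-- The quotient category `C / P` by a Serre subcategory `P` is abelian. -/
noncomputable instance quotientAbelian (P : ObjectProperty C) [P.IsSerreClass] :
    Abelian P.isoModSerre.Localization :=
  ObjectProperty.SerreClassLocalization.abelian P.isoModSerre.Q P

/-- A Serre subcategory `P` is localizing if the canonical functor `C ⥤ C / P` has
a right adjoint. -/
def IsLocalizing (P : ObjectProperty C) : Prop :=
  ∃ _ : P.IsSerreClass, P.isoModSerre.Q.IsLeftAdjoint

/-- The smallest localizing subcategory containing `S`: the intersection of all localizing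
subcategories that contain `S`. -/
def locGen (S : ObjectProperty C) : ObjectProperty C :=
  fun X => ∀ P : ObjectProperty C, IsLocalizing P → S ≤ P → P X

instance (S : ObjectProperty C) : (locGen S).IsSerreClass where
  exists_zero := by
    refine ⟨_, isZero_zero C, fun P hP _ => ?_⟩
    obtain ⟨_, _⟩ := hP
    exact P.prop_zero
  prop_of_mono f _ hY P hP hS := by
    obtain ⟨_, _⟩ := id hP
    exact P.prop_of_mono f (hY P hP hS)
  prop_of_epi f _ hX P hP hS := by
    obtain ⟨_, _⟩ := id hP
    exact P.prop_of_epi f (hX P hP hS)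
  prop_X₂_of_shortExact h h₁ h₃ P hP hS := by
    obtain ⟨_, _⟩ := id hP
    exact P.prop_X₂_of_shortExact h (h₁ P hP hS) (h₃ P hP hS)

variable (C) in
/-- The smallest localizing subcategory containing all simple objects. -/
def simpleLoc : ObjectProperty C := locGen (fun X => Simple X)

instance : (simpleLoc C).IsSerreClass := inferInstanceAs (locGen _).IsSerreClass

/-- The objects of `C` whose image in `C / P` lies in the smallest localizing subcategory of
`C / P` containing all simple objects of `C / P`. -/
def nextLoc (P : ObjectProperty C) [P.IsSerreClass] : ObjectProperty C :=
  (simpleLoc P.isoModSerre.Localization).inverseImage P.isoModSerre.Q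

instance (P : ObjectProperty C) [P.IsSerreClass] : (nextLoc P).IsSerreClass := by
  have := ObjectProperty.SerreClassLocalization.preservesFiniteLimits P.isoModSerre.Q P
  have := ObjectProperty.SerreClassLocalization.preservesFiniteColimits P.isoModSerre.Q P
  exact inferInstanceAs (ObjectProperty.inverseImage _ _).IsSerreClass

variable (C) in
/-- The Gabriel-Krull filtration at the ordinals `σ ≥ 0`. -/
noncomputable def gkFiltrationAux (σ : Ordinal.{w}) :
    {P : ObjectProperty C // P.IsSerreClass} :=
  Ordinal.limitRecOn (motive := fun _ => {P : ObjectProperty C // P.IsSerreClass}) σ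
    ⟨simpleLoc C, inferInstance⟩
    (fun _ P => letI := P.2; ⟨nextLoc P.1, inferInstance⟩)
    (fun σ _ P => ⟨locGen (fun X => ∃ (ρ : Ordinal.{w}) (h : ρ < σ), (P ρ h).1 X), inferInstance⟩)

variable (C) in
/-- The Gabriel-Krull filtration `C_σ`, indexed by `-1` (written `⊥`) and the ordinals:
`C_{-1}` is the zero subcategory, `C_0` is the smallest localizing subcategory containing all
simple objects, `C_{ρ+1}` consists of the objects whose image in `C / C_ρ` lies in `(C / C_ρ)_0`,
and for a limit ordinal `σ`, `C_σ` is generated as a localizing subcategory by the `C_ρ`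
with `ρ < σ`. -/
noncomputable def gkFiltration : WithBot Ordinal.{w} → ObjectProperty C
  | ⊥ => IsZero
  | (σ : Ordinal.{w}) => (gkFiltrationAux C σ).1

/-- `GKdim M` exists and equals `σ`: `σ` is the least element of `{-1} ∪ Ord`
with `M ∈ C_σ`. -/
def IsGKDim (M : C) (σ : WithBot Ordinal.{w}) : Prop :=
  IsLeast {ρ : WithBot Ordinal.{w} | gkFiltration C ρ M} σ

/-- There is a strict chain of atoms `α_0 < α_1 < ... < α_σ` in `ASupp M` such that `α_0` belongs
to `ASupp C_σ` but not to `ASupp C_{σ₁}`, where `σ = σ₁ + 1` (and `σ₁ = -1` if `σ = 0`). -/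
def HasAtomChain (M : C) (σ : Ordinal.{w}) : Prop :=
  ∃ a : Set.Iic σ → ASpec C, StrictMono a ∧ (∀ i, a i ∈ ASupp M) ∧
    ∃ σ₁ : WithBot Ordinal.{w}, (σ : WithBot Ordinal.{w}) = Order.succ σ₁ ∧
      a ⟨0, Set.mem_Iic.2 zero_le⟩ ∈ ASuppOf (gkFiltration C (σ : WithBot Ordinal.{w})) ∧
      a ⟨0, Set.mem_Iic.2 zero_le⟩ ∉ ASuppOf (gkFiltration C σ₁)

/-- `dim M` exists and equals `σ`: `σ` is the largest ordinal for which there is a chain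
as in `HasAtomChain`. -/
def IsDim (M : C) (σ : Ordinal.{w}) : Prop :=
  IsGreatest {ρ : Ordinal.{w} | HasAtomChain M ρ} σ

variable (C) in
/-- `C` has a small generating set of noetherian objects. -/
def IsLocallyNoetherian : Prop :=
  ∃ (ι : Type w) (G : ι → C), (∀ i, IsNoetherianObject (G i)) ∧
    (ObjectProperty.ofObj G).IsSeparating

end Localizing

end AtomDimension

open AtomDimension

namespace AtomDimension

/-! The inequality is formal. If `M` lies in `C_σ`, so do the atoms of `M`. The first atom of a
chain avoids `ASupp C_{σ₁}`, and the filtration is increasing, so `σ₁ < σ`. The rest of the chain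
plays no role (`HasAtomChain.le_of_gkFiltration`).

For equality it remains to put `M` into `C_κ`. Three facts carry this. (1) The objects supported in
a fixed set of atoms form a localizing subcategory, so generating a localizing subcategory creates
no new atoms (`ASuppOf_locGen`). Over a locally noetherian category, support in turn determines a
localizing subcategory (`IsLocalizing.prop_of_ASupp_subset`). (2) An atom first appearing at level
`ρ + 1` has a monoform representative whose proper quotients all lie in `C_ρ`. Hence every strictly
larger atom lies in `ASupp C_ρ` (`mem_ASuppOf_of_lt`): going up in the order lowers the level, and
no chain is infinite, so `κ` is some natural number `n`. (3) If the space is Alexandroff, the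
converse of (2) holds: an atom all of whose strictly larger atoms lie in `ASupp C_ρ` is in `ASupp
C_{ρ+1}` (`mem_ASuppOf_succ_of_forall_lt`). Hence an atom first appearing at level `n` starts a
chain with `n` steps (`exists_chain`).

If `M` were not in `C_n`, then (1) would give atoms of `M` outside `ASupp C_n`. One of lowest level
first appears at `n + 1` by (2) and (3), and starts a chain too long for `dim M = n`. -/

theorem counit_isIso_of_isLocalization {C D : Type*} [Category* C] [Category* D]
    (W : MorphismProperty C)
    {L : C ⥤ D} [L.IsLocalization W] {G : D ⥤ C} (adj : L ⊣ G) : IsIso adj.counit := by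
  -- The image of the unit under `L` descends to `D`; the triangle identities make it inverse to the
  -- counit.
  let ε : 𝟭 D ⟶ G ⋙ L := Localization.liftNatTrans L W L (L ⋙ G ⋙ L) (𝟭 D) (G ⋙ L)
    (Functor.whiskerRight adj.unit L)
  have hε (X : C) : ε.app (L.obj X) = L.map (adj.unit.app X) := by
    simp [ε, Localization.Lifting.iso]
  have := Localization.essSurj L W
  have hεe (Y : D) : ε.app Y ≫ adj.counit.app Y = 𝟙 Y := by
    let e := L.objObjPreimageIso Y
    have h := ε.naturality e.hom
    dsimp at h
    rw [← cancel_epi e.hom, reassoc_of% h, hε]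
    erw [adj.counit_naturality]
    simp
  have heε (Y : D) : adj.counit.app Y ≫ ε.app Y = 𝟙 _ := by
    have h := ε.naturality (adj.counit.app Y)
    dsimp at h
    rw [h, hε, ← Functor.map_comp, adj.right_triangle_components]
    exact L.map_id _
  have (Y : D) : IsIso (adj.counit.app Y) := ⟨ε.app Y, heε Y, hεe Y⟩
  exact NatIso.isIso_of_isIso_app _

/-! ### Morphisms in the quotient by a Serre subcategory -/

section QuotientFunctor

variable {C : Type u} [Category.{v} C] [Abelian C] (P : ObjectProperty C) [P.IsSerreClass]

instance : PreservesFiniteLimits P.isoModSerre.Q :=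
  ObjectProperty.SerreClassLocalization.preservesFiniteLimits P.isoModSerre.Q P

instance : PreservesFiniteColimits P.isoModSerre.Q :=
  ObjectProperty.SerreClassLocalization.preservesFiniteColimits P.isoModSerre.Q P

theorem isZero_quotient_iff (X : C) : IsZero (P.isoModSerre.Q.obj X) ↔ P X :=
  ObjectProperty.SerreClassLocalization.isZero_obj_iff P.isoModSerre.Q P X

theorem isIso_quotient_iff {X Y : C} (f : X ⟶ Y) :
    IsIso (P.isoModSerre.Q.map f) ↔ P.isoModSerre f :=
  ObjectProperty.SerreClassLocalization.isIso_map_iff P.isoModSerre.Q P f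

theorem quotient_map_eq_zero_iff {X Y : C} (f : X ⟶ Y) :
    P.isoModSerre.Q.map f = 0 ↔ P (Abelian.image f) :=
  ObjectProperty.SerreClassLocalization.map_eq_zero_iff P.isoModSerre.Q P f

theorem isoModSerre_cokernelπ {X Y : C} (i : X ⟶ Y) [Mono i] (h : P X) :
    P.isoModSerre (cokernel.π i) :=
  P.isoModSerre_of_epi _ (P.prop_of_iso
    (IsLimit.conePointUniqueUpToIso (Abelian.monoIsKernelOfCokernel _ (colimit.isColimit _))
      (limit.isLimit _)) h)

/-- Every morphism in the quotient category is represented by a morphism from a subobject of the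
source to a quotient of the target. -/
theorem exists_subobject_fraction {X Y : C}
    (f : P.isoModSerre.Q.obj X ⟶ P.isoModSerre.Q.obj Y) :
    ∃ (A : Subobject X) (B : Subobject Y) (g : (A : C) ⟶ cokernel B.arrow),
      P.isoModSerre A.arrow ∧ P.isoModSerre (cokernel.π B.arrow) ∧
      P.isoModSerre.Q.map A.arrow ≫ f ≫ P.isoModSerre.Q.map (cokernel.π B.arrow) =
        P.isoModSerre.Q.map g := by
  obtain ⟨φ, rfl⟩ := Localization.exists_rightFraction P.isoModSerre.Q P.isoModSerre f
  have hfac := φ.map_s_comp_map P.isoModSerre.Q (Localization.inverts _ _)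
  generalize φ.map P.isoModSerre.Q (Localization.inverts _ _) = f at hfac
  obtain ⟨s, hs, t⟩ := φ
  dsimp at hfac
  -- `B` is the image of `kernel s` under `t`: it lies in `P`, and dividing by it lets `t` descend
  -- to the image of `s`.
  let B : Subobject Y := Subobject.mk (Abelian.image.ι (kernel.ι s ≫ t))
  have hker : P (kernel s) := hs.1
  have hB : P (B : C) :=
    P.prop_of_iso (Subobject.underlyingIso _).symm
      (P.prop_of_epi (Abelian.factorThruImage (kernel.ι s ≫ t)) hker)
  let e := Subobject.underlyingIso (Abelian.image.ι s)
  let p := Abelian.factorThruImage s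
  have hp : p ≫ e.inv ≫ (Subobject.mk (Abelian.image.ι s)).arrow = s := by simp [e, p]
  have hps : kernel.ι p ≫ s = 0 := by
    refine (congrArg (kernel.ι p ≫ ·) hp.symm).trans ?_
    simp
  have hp' : P.isoModSerre p := by
    exact P.isoModSerre_of_epi _ (P.prop_of_mono (kernel.lift s (kernel.ι p) hps) hker)
  have : IsIso (P.isoModSerre.Q.map p) := (isIso_quotient_iff P p).2 hp'
  have : IsIso (P.isoModSerre.Q.map s) := (isIso_quotient_iff P s).2 hs
  have hz : kernel.ι p ≫ t ≫ cokernel.π B.arrow = 0 := by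
    have h0 : kernel.ι s ≫ t ≫ cokernel.π B.arrow = 0 := by
      have : kernel.ι s ≫ t = (Abelian.factorThruImage (kernel.ι s ≫ t) ≫
          (Subobject.underlyingIso (Abelian.image.ι (kernel.ι s ≫ t))).inv) ≫ B.arrow := by
        simp [B]
      rw [← Category.assoc, this, Category.assoc, cokernel.condition, comp_zero]
    have h1 : kernel.ι p = kernel.lift s (kernel.ι p) hps ≫ kernel.ι s := by simp
    rw [h1, Category.assoc, h0, comp_zero]
  refine ⟨Subobject.mk (Abelian.image.ι s), B,
    e.hom ≫ Abelian.epiDesc p (t ≫ cokernel.π B.arrow) hz, ?_,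
    isoModSerre_cokernelπ P B.arrow hB, ?_⟩
  · rw [← isIso_quotient_iff]
    have h2 : P.isoModSerre.Q.map p ≫ P.isoModSerre.Q.map e.inv ≫
        P.isoModSerre.Q.map (Subobject.mk (Abelian.image.ι s)).arrow = P.isoModSerre.Q.map s := by
      rw [← Functor.map_comp, ← Functor.map_comp, hp]
    rw [← Category.assoc] at h2
    exact IsIso.of_isIso_fac_left h2
  · have : Epi (P.isoModSerre.Q.map (p ≫ e.inv)) := by
      rw [Functor.map_comp]
      infer_instance
    rw [← cancel_epi (P.isoModSerre.Q.map (p ≫ e.inv)), ← Functor.map_comp_assoc,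
      ← Functor.map_comp]
    have h3 : (p ≫ e.inv) ≫ (Subobject.mk (Abelian.image.ι s)).arrow = s := by
      rw [Category.assoc, hp]
    have h4 : (p ≫ e.inv) ≫ e.hom ≫ Abelian.epiDesc p (t ≫ cokernel.π B.arrow) hz =
        t ≫ cokernel.π B.arrow := by simp
    rw [h3, h4, reassoc_of% hfac, Functor.map_comp]

/-- Each hom-set is covered by triples (subobject, subobject, morphism), of which there is only a
small set. The adjoint functor theorem needs this smallness. -/
instance locallySmall_quotient [LocallySmall.{w} C] [WellPowered.{w} C] :
    LocallySmall.{w} P.isoModSerre.Localization := by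
  have key (X Y : C) : Small.{w} (P.isoModSerre.Q.obj X ⟶ P.isoModSerre.Q.obj Y) := by
    let I := Σ (A : {A : Subobject X // P.isoModSerre A.arrow})
      (B : {B : Subobject Y // P.isoModSerre (cokernel.π B.arrow)}),
        ((A.1 : C) ⟶ cokernel B.1.arrow)
    refine small_of_surjective.{w} (α := I) (f := fun z =>
      (Localization.isoOfHom P.isoModSerre.Q P.isoModSerre _ z.1.2).inv ≫
        P.isoModSerre.Q.map z.2.2 ≫
        (Localization.isoOfHom P.isoModSerre.Q P.isoModSerre _ z.2.1.2).inv) fun f => ?_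
    obtain ⟨A, B, g, hA, hB, h⟩ := exists_subobject_fraction P f
    refine ⟨⟨⟨A, hA⟩, ⟨B, hB⟩, g⟩, ?_⟩
    dsimp only
    rw [← h, Iso.inv_comp_eq, ← Category.assoc, Iso.comp_inv_eq, Category.assoc, Category.assoc]
    rfl
  have := Localization.essSurj P.isoModSerre.Q P.isoModSerre
  refine ⟨fun X Y => ?_⟩
  have := key (P.isoModSerre.Q.objPreimage X) (P.isoModSerre.Q.objPreimage Y)
  exact small_of_injective (β := P.isoModSerre.Q.obj (P.isoModSerre.Q.objPreimage X) ⟶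
    P.isoModSerre.Q.obj (P.isoModSerre.Q.objPreimage Y))
    (f := fun f => (P.isoModSerre.Q.objObjPreimageIso X).hom ≫ f ≫
      (P.isoModSerre.Q.objObjPreimageIso Y).inv) (fun f g h => by simpa using h)

end QuotientFunctor

/-! ### Localizing subcategories and coproducts -/

section Gabriel

variable {C : Type u} [Category.{v} C] [Abelian C] (P : ObjectProperty C) [P.IsSerreClass]

/-- Exact coproducts commute with kernels and cokernels. -/
theorem isoModSerre_sigmaMap {J : Type w} [HasColimitsOfShape (Discrete J) C]
    [HasExactColimitsOfShape (Discrete J) C] [P.IsClosedUnderColimitsOfShape (Discrete J)]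
    {X Y : J → C} (s : ∀ j, X j ⟶ Y j) (h : ∀ j, P.isoModSerre (s j)) :
    P.isoModSerre (Limits.Sigma.map s) := by
  let φ : Discrete.functor X ⟶ Discrete.functor Y := Discrete.natTrans fun j => s j.as
  have e₁ : colim.map φ = Limits.Sigma.map s := rfl
  have hk (j) : P ((kernel φ).obj j) :=
    P.prop_of_iso (PreservesKernel.iso ((evaluation _ _).obj j) φ).symm (h j.as).1
  have hc (j) : P ((cokernel φ).obj j) :=
    P.prop_of_iso (PreservesCokernel.iso ((evaluation _ _).obj j) φ).symm (h j.as).2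
  have hk' : P (colim.obj (kernel φ)) := P.prop_colimit _ hk
  have hc' : P (colim.obj (cokernel φ)) := P.prop_colimit _ hc
  rw [← e₁]
  constructor
  · exact P.prop_of_iso (PreservesKernel.iso colim φ) hk'
  · exact P.prop_of_iso (PreservesCokernel.iso colim φ) hc'

theorem prop_of_jointly_epi {J : Type w} [HasColimitsOfShape (Discrete J) C]
    [P.IsClosedUnderColimitsOfShape (Discrete J)]
    {X : J → C} {Y : C} (f : ∀ j, X j ⟶ Y) (h : ∀ j, P (X j)) (hf : Epi (Sigma.desc f)) : P Y :=
  P.prop_of_epi (Sigma.desc f) (P.prop_colimit _ fun j => h j.as)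

theorem preservesCoproducts_quotient {J : Type w} [HasColimitsOfShape (Discrete J) C]
    [HasExactColimitsOfShape (Discrete J) C] [P.IsClosedUnderColimitsOfShape (Discrete J)] :
    PreservesColimitsOfShape (Discrete J) P.isoModSerre.Q := by
  have := Localization.essSurj P.isoModSerre.Q P.isoModSerre
  -- Uniqueness: the image of the numerator of `g` is covered by the images of its restrictions to
  -- the summands, all of which lie in `P`.
  have key (X : J → C) (W : P.isoModSerre.Localization)
      (g : P.isoModSerre.Q.obj (∐ X) ⟶ W) (hg : ∀ j, P.isoModSerre.Q.map (Sigma.ι X j) ≫ g = 0) :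
      g = 0 := by
    let e := P.isoModSerre.Q.objObjPreimageIso W
    obtain ⟨φ, hφ⟩ := Localization.exists_leftFraction P.isoModSerre.Q P.isoModSerre (g ≫ e.inv)
    have h1 := φ.map_comp_map_s P.isoModSerre.Q (Localization.inverts _ _)
    rw [← hφ] at h1
    have : IsIso (P.isoModSerre.Q.map φ.s) := (isIso_quotient_iff P _).2 φ.hs
    suffices P.isoModSerre.Q.map φ.f = 0 by
      rw [this] at h1
      exact Preadditive.IsIso.comp_right_eq_zero _ e.inv |>.1
        (Preadditive.IsIso.comp_right_eq_zero _ (P.isoModSerre.Q.map φ.s) |>.1 h1)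
    rw [quotient_map_eq_zero_iff P]
    have h2 (j) : P (Abelian.image (Sigma.ι X j ≫ φ.f)) := by
      rw [← quotient_map_eq_zero_iff P, Functor.map_comp, ← h1, Category.assoc, reassoc_of% (hg j),
        zero_comp]
    have hz (j) : Abelian.image.ι (Sigma.ι X j ≫ φ.f) ≫ cokernel.π φ.f = 0 := by
      rw [← cancel_epi (Abelian.factorThruImage (Sigma.ι X j ≫ φ.f))]
      simp
    let a (j) : Abelian.image (Sigma.ι X j ≫ φ.f) ⟶ Abelian.image φ.f :=
      kernel.lift _ (Abelian.image.ι (Sigma.ι X j ≫ φ.f)) (hz j)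
    have ha (j) : a j ≫ Abelian.image.ι φ.f = Abelian.image.ι (Sigma.ι X j ≫ φ.f) :=
      kernel.lift_ι _ _ _
    refine prop_of_jointly_epi P a h2 ?_
    have : (Limits.Sigma.map fun j => Abelian.factorThruImage (Sigma.ι X j ≫ φ.f)) ≫ Sigma.desc a =
        Abelian.factorThruImage φ.f := by
      refine Sigma.hom_ext _ _ fun j => ?_
      refine (cancel_mono (Abelian.image.ι φ.f)).1 ?_
      simp only [Sigma.ι_map_assoc, Category.assoc, Sigma.ι_desc_assoc, ha]
      exact (Abelian.image.fac _).trans (congrArg _ (Abelian.image.fac _).symm)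
    exact epi_of_epi_fac this
  have : ∀ X : J → C, PreservesColimit (Discrete.functor X) P.isoModSerre.Q := fun X => by
    refine preservesColimit_of_preserves_colimit_cocone (coproductIsCoproduct X)
      ((isColimitMapCoconeCofanMkEquiv _ _ _).symm ?_)
    have hfr (t : Cofan fun j => P.isoModSerre.Q.obj (X j)) (j : J) :
        ∃ (X' : C) (s : X' ⟶ X j) (f : X' ⟶ P.isoModSerre.Q.objPreimage t.pt),
          P.isoModSerre s ∧ P.isoModSerre.Q.map s ≫ t.inj j =
            P.isoModSerre.Q.map f ≫ (P.isoModSerre.Q.objObjPreimageIso t.pt).hom := by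
      obtain ⟨φ, hφ⟩ := Localization.exists_rightFraction P.isoModSerre.Q P.isoModSerre
        (t.inj j ≫ (P.isoModSerre.Q.objObjPreimageIso t.pt).inv)
      refine ⟨φ.X', φ.s, φ.f, φ.hs, ?_⟩
      rw [← φ.map_s_comp_map P.isoModSerre.Q (Localization.inverts _ _), ← hφ]
      simp
    -- Existence: the coproduct of the denominators `s j` is a common denominator.
    have hex (t : Cofan fun j => P.isoModSerre.Q.obj (X j)) :
        ∃ d : P.isoModSerre.Q.obj (∐ X) ⟶ t.pt,
          ∀ j, P.isoModSerre.Q.map (Sigma.ι X j) ≫ d = t.inj j := by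
      choose X' s f hs h using hfr t
      have : IsIso (P.isoModSerre.Q.map (Limits.Sigma.map s)) :=
        (isIso_quotient_iff P _).2 (isoModSerre_sigmaMap P s hs)
      refine ⟨inv (P.isoModSerre.Q.map (Limits.Sigma.map s)) ≫
        P.isoModSerre.Q.map (Sigma.desc f) ≫ (P.isoModSerre.Q.objObjPreimageIso t.pt).hom,
        fun j => ?_⟩
      have : IsIso (P.isoModSerre.Q.map (s j)) := (isIso_quotient_iff P _).2 (hs j)
      rw [← cancel_epi (P.isoModSerre.Q.map (s j)), h, ← Functor.map_comp_assoc,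
        ← Sigma.ι_map s, Functor.map_comp_assoc, IsIso.hom_inv_id_assoc,
        ← Functor.map_comp_assoc, Sigma.ι_desc]
    choose d hd using hex
    refine Cofan.IsColimit.mk _ d hd fun t m hm => ?_
    rw [← sub_eq_zero]
    refine key X _ _ fun j => ?_
    rw [Preadditive.comp_sub, sub_eq_zero, hd]
    exact hm j
  exact preservesColimitsOfShape_of_discrete _

/-- A Serre subcategory of a Grothendieck category that is closed under coproducts is
localizing. -/
theorem isLocalizing_of_closedUnderCoproducts [IsGrothendieckAbelian.{w} C]
    [∀ J : Type w, P.IsClosedUnderColimitsOfShape (Discrete J)] : IsLocalizing P := by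
  refine ⟨inferInstance, ?_⟩
  have (J : Type w) : PreservesColimitsOfShape (Discrete J) P.isoModSerre.Q :=
    preservesCoproducts_quotient P
  have : PreservesColimitsOfSize.{w, w} P.isoModSerre.Q :=
    preservesColimits_of_preservesCoequalizers_and_coproducts _
  -- The adjoint functor theorem is applied to equivalent categories with hom-sets in `w`, and the
  -- adjoint is carried back.
  let eC := ShrinkHoms.equivalence.{w} C
  let eD := ShrinkHoms.equivalence.{w} P.isoModSerre.Localization
  let F := eC.inverse ⋙ P.isoModSerre.Q ⋙ eD.functor
  have : PreservesColimits F := inferInstance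
  have : F.IsLeftAdjoint :=
    isLeftAdjoint_of_preservesColimits_of_isSeparating (isSeparator_separator (ShrinkHoms C)) F
  have : (eC.functor ⋙ F ⋙ eD.inverse).IsLeftAdjoint := inferInstance
  refine Functor.isLeftAdjoint_of_iso (F := eC.functor ⋙ F ⋙ eD.inverse) ?_
  exact Functor.isoWhiskerRight eC.unitIso.symm (P.isoModSerre.Q ⋙ eD.functor ⋙ eD.inverse) ≪≫
    Functor.isoWhiskerLeft P.isoModSerre.Q eD.unitIso.symm

theorem IsLocalizing.isClosedUnderColimitsOfShape {P : ObjectProperty C} (hP : IsLocalizing P)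
    (J : Type*) [Category* J] : P.IsClosedUnderColimitsOfShape J := by
  obtain ⟨_, h⟩ := hP
  refine ⟨fun X ⟨h⟩ => ?_⟩
  have : PreservesColimitsOfShape J P.isoModSerre.Q :=
    (Adjunction.ofIsLeftAdjoint P.isoModSerre.Q).leftAdjoint_preservesColimits.1
  rw [← isZero_quotient_iff P]
  have hz (j) : IsZero (P.isoModSerre.Q.obj (h.diag.obj j)) :=
    (isZero_quotient_iff P _).2 (h.prop_diag_obj j)
  rw [IsZero.iff_id_eq_zero]
  exact (isColimitOfPreserves P.isoModSerre.Q h.isColimit).hom_ext fun j => (hz j).eq_of_src _ _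

/-- The quotient of a Grothendieck category by a localizing subcategory is Grothendieck. -/
theorem isGrothendieckAbelian_quotient [IsGrothendieckAbelian.{w} C]
    [P.isoModSerre.Q.IsLeftAdjoint] :
    IsGrothendieckAbelian.{w} P.isoModSerre.Localization := by
  let adj := Adjunction.ofIsLeftAdjoint P.isoModSerre.Q
  have := counit_isIso_of_isLocalization P.isoModSerre adj
  have := adj.fullyFaithfulROfIsIsoCounit.full
  have := adj.fullyFaithfulROfIsIsoCounit.faithful
  have : Reflective P.isoModSerre.Q.rightAdjoint := { L := P.isoModSerre.Q, adj := adj }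
  have : HasFilteredColimitsOfSize.{w, w} P.isoModSerre.Localization :=
    ⟨fun J _ _ => hasColimitsOfShape_of_reflective P.isoModSerre.Q.rightAdjoint⟩
  refine { ab5OfSize := ⟨fun J _ _ => adj.hasExactColimitsOfShape J⟩, hasSeparator := ?_ }
  refine ⟨P.isoModSerre.Q.obj (separator C), ?_⟩
  refine (isSeparator_def _).2 fun X Y f g h => ?_
  apply P.isoModSerre.Q.rightAdjoint.map_injective
  refine (isSeparator_separator C).def _ _ fun k => ?_
  apply (adj.homEquiv _ _).symm.injective
  rw [adj.homEquiv_naturality_right_symm, adj.homEquiv_naturality_right_symm]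
  exact h _

end Gabriel

/-! ### Atom supports and the subcategories they define -/

section Support

variable {C : Type u} [Category.{v} C] [Abelian C]

theorem IsSubquotient.prop {P : ObjectProperty C} [P.IsSerreClass] {H M : C}
    (h : IsSubquotient H M) (hM : P M) : P H := by
  obtain ⟨N, i, p, _, _⟩ := h
  exact P.prop_of_epi p (P.prop_of_mono i hM)

theorem atomOf_eq_of_mono {H L : C} (hH : IsMonoform H) (j : L ⟶ H) [Mono j] (hL : ¬ IsZero L) :
    atomOf L (hH.of_mono j hL) = atomOf H hH :=
  Quotient.sound ⟨L, hL, ⟨𝟙 L, inferInstance⟩, ⟨j, inferInstance⟩⟩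

theorem atomOf_mem_ASupp {H : C} (hH : IsMonoform H) : atomOf H hH ∈ ASupp H :=
  ⟨H, hH, rfl, H, 𝟙 H, 𝟙 H, inferInstance, inferInstance⟩

/-- A nonzero morphism from a subobject of `M` to a monoform object `H` puts the atom of `H`
in the support of `M`. -/
theorem atomOf_mem_ASupp_of_ne_zero {N M H : C} (i : N ⟶ M) [Mono i] (g : N ⟶ H) (hg : g ≠ 0)
    (hH : IsMonoform H) : atomOf H hH ∈ ASupp M := by
  have hz : ¬ IsZero (Abelian.image g) := fun hz => hg ((Abelian.image.fac g).symm.trans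
    (by rw [hz.eq_zero_of_src (Abelian.image.ι g), comp_zero]))
  exact ⟨Abelian.image g, hH.of_mono (Abelian.image.ι g) hz,
    atomOf_eq_of_mono hH (Abelian.image.ι g) hz, N, i,
    Abelian.factorThruImage g, inferInstance, inferInstance⟩

theorem mono_cokernel_map_comp {K L R : C} (k : K ⟶ L) (g : L ⟶ R) [Mono g] :
    Mono (cokernel.map k (k ≫ g) (𝟙 K) g (by simp)) := by
  have sq : IsPullback k (𝟙 K) g (k ≫ g) := by
    refine IsPullback.of_isLimit' ⟨by simp⟩ (PullbackCone.IsLimit.mk _ (fun s => s.snd) ?_ ?_ ?_)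
    · intro s
      rw [← cancel_mono g, Category.assoc, s.condition]
    · intro s
      simp
    · intro s m _ h
      simpa using h
  exact Abelian.mono_cokernel_map_of_isPullback sq

theorem IsMonoform.epi_ne_zero {N H : C} (hH : IsMonoform H) (p : N ⟶ H) [Epi p] : p ≠ 0 := by
  rintro rfl
  exact hH.1 (IsZero.of_epi_zero N H)

theorem ASupp_subset_of_epi {M N : C} (p : M ⟶ N) [Epi p] : ASupp N ⊆ ASupp M := by
  rintro α ⟨H, hH, rfl, K, i, q, _, _⟩
  exact ⟨H, hH, rfl, pullback p i, pullback.fst p i, pullback.snd p i ≫ q, inferInstance,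
    inferInstance⟩

/-- For `p : N ⟶ H` with `N ⊆ X₂`, either `p` is nonzero on `N ∩ X₁`, whose image then represents
the atom of `H`, or `p` factors through the image of `N` in `X₃`. -/
theorem ASupp_subset_of_shortExact {S : ShortComplex C} (hS : S.ShortExact) :
    ASupp S.X₂ ⊆ ASupp S.X₁ ∪ ASupp S.X₃ := by
  rintro α ⟨H, hH, rfl, N, i, p, _, _⟩
  have := hS.mono_f
  by_cases h : pullback.fst i S.f ≫ p = 0
  · right
    let m := i ≫ S.g
    have hk : kernel.ι m ≫ p = 0 := by
      have h0 : (kernel.ι m ≫ i) ≫ S.g = 0 := by simp [m]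
      have h1 : hS.fIsKernel.lift (KernelFork.ofι _ h0) ≫ S.f = kernel.ι m ≫ i :=
        hS.fIsKernel.fac (KernelFork.ofι _ h0) WalkingParallelPair.zero
      have h2 := pullback.lift_fst (f := i) (g := S.f) (kernel.ι m) _ h1.symm
      rw [← h2, Category.assoc, h, comp_zero]
    have hz : kernel.ι (Abelian.factorThruImage m) ≫ p = 0 := by
      have h3 : kernel.ι (Abelian.factorThruImage m) ≫ m = 0 := by
        refine (congrArg (_ ≫ ·) (Abelian.image.fac m).symm).trans ?_
        rw [kernel.condition_assoc, zero_comp]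
      rw [← kernel.lift_ι m _ h3, Category.assoc, hk, comp_zero]
    refine atomOf_mem_ASupp_of_ne_zero (Abelian.image.ι m)
      (Abelian.epiDesc (Abelian.factorThruImage m) p hz) ?_ hH
    intro h0
    refine hH.epi_ne_zero p ?_
    rw [← Abelian.comp_epiDesc (Abelian.factorThruImage m) p hz, h0, comp_zero]
  · exact Or.inl (atomOf_mem_ASupp_of_ne_zero (pullback.snd i S.f) _ h hH)

theorem ASupp_eq_empty_of_isZero {X : C} (hX : IsZero X) : ASupp X = ∅ := by
  refine Set.eq_empty_of_forall_notMem ?_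
  rintro α ⟨H, hH, rfl, h⟩
  exact hH.1 (h.prop (P := IsZero) hX)

/-- The objects whose support is contained in a given set of atoms. -/
def supportIn (Φ : Set (ASpec C)) : ObjectProperty C := fun X => ASupp X ⊆ Φ

instance (Φ : Set (ASpec C)) : (supportIn Φ).IsSerreClass where
  exists_zero := ⟨_, isZero_zero C, by
    rw [supportIn, ASupp_eq_empty_of_isZero (isZero_zero C)]
    exact Set.empty_subset _⟩
  prop_of_mono f _ hY := (ASupp_subset_of_mono f).trans hY
  prop_of_epi f _ hX := (ASupp_subset_of_epi f).trans hX
  prop_X₂_of_shortExact h h₁ h₃ :=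
    (ASupp_subset_of_shortExact h).trans (Set.union_subset h₁ h₃)

/-- A subobject `N` of the colimit is covered by its preimages in the terms, so a nonzero `N ⟶ H` is
nonzero on one of them, and the atom of `H` is already in the support of that term. -/
theorem supportIn_isClosedUnderFilteredColimits [IsGrothendieckAbelian.{w} C]
    (Φ : Set (ASpec C)) (J : Type w) [SmallCategory J] [IsFiltered J] :
    (supportIn Φ).IsClosedUnderColimitsOfShape J := by
  refine ⟨fun X ⟨h⟩ => ?_⟩
  rintro α ⟨H, hH, rfl, N, i, p, _, _⟩
  let c := h.cocone
  have hc : IsColimit c := h.isColimit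
  let i' : N ⟶ c.pt := i
  have hi' : Mono i' := ‹Mono i›
  have : Epi (IsGrothendieckAbelian.IsPresentable.surjectivity.f (c := c) i') :=
    IsGrothendieckAbelian.IsPresentable.surjectivity.epi_f hc i'
  by_contra hα
  refine hH.epi_ne_zero p ?_
  rw [← cancel_epi (IsGrothendieckAbelian.IsPresentable.surjectivity.f (c := c) i'), comp_zero]
  refine colimit.hom_ext fun j => ?_
  rw [comp_zero, ← Category.assoc, IsGrothendieckAbelian.IsPresentable.surjectivity.hf]
  by_contra h0
  have : Mono ((Functor.const J).map i') := by
    have : ∀ j, Mono (((Functor.const J).map i').app j) := fun j => hi'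
    exact NatTrans.mono_of_mono_app _
  have : Mono ((pullback.fst c.ι ((Functor.const J).map i')).app j) := inferInstance
  exact hα (h.prop_diag_obj j (atomOf_mem_ASupp_of_ne_zero
    ((pullback.fst c.ι ((Functor.const J).map i')).app j) _ h0 hH))

theorem prop_finite_coproduct (P : ObjectProperty C) [P.IsSerreClass] {J : Type*} [Finite J]
    (X : J → C) (h : ∀ j, P (X j)) : P (∐ X) := by
  have : P.IsClosedUnderBinaryCoproducts := by
    refine ⟨fun Y ⟨h⟩ => ?_⟩
    let e : pair _ _ ≅ h.diag := (diagramIsoPair h.diag).symm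
    exact P.prop_of_iso
      ((IsColimit.precomposeHomEquiv e _).symm h.isColimit |>.coconePointUniqueUpToIso
        (BinaryBiproduct.isColimit _ _)).symm
      (P.prop_biprod (h.prop_diag_obj _) (h.prop_diag_obj _))
  have : P.IsClosedUnderFiniteCoproducts := .mk'
  exact P.prop_coproduct h

instance [IsGrothendieckAbelian.{w} C] (Φ : Set (ASpec C)) (J : Type w) :
    (supportIn Φ).IsClosedUnderColimitsOfShape (Discrete J) := by
  refine ObjectProperty.IsClosedUnderColimitsOfShape.mk' ?_
  rintro _ ⟨F, hF⟩
  have := supportIn_isClosedUnderFilteredColimits.{w} Φ (Finset (Discrete J))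
  refine (supportIn Φ).prop_of_iso (IsColimit.coconePointUniqueUpToIso
    (CoproductsFromFiniteFiltered.liftToFinsetColimitCocone F).isColimit (colimit.isColimit F)) ?_
  refine (supportIn Φ).prop_colimit (CoproductsFromFiniteFiltered.liftToFinsetObj F) fun s => ?_
  exact prop_finite_coproduct (supportIn Φ) (fun x : s => F.obj x) fun j => hF _

theorem supportIn_isLocalizing [IsGrothendieckAbelian.{w} C] (Φ : Set (ASpec C)) :
    IsLocalizing (supportIn Φ) :=
  isLocalizing_of_closedUnderCoproducts.{w} _

theorem ASuppOf_mono {P P' : ObjectProperty C} (h : P ≤ P') : ASuppOf P ⊆ ASuppOf P' :=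
  fun _ ⟨M, hM, hα⟩ => ⟨M, h _ hM, hα⟩

/-- The objects supported in `ASuppOf S` form one of the localizing subcategories being intersected.
-/
theorem ASuppOf_locGen [IsGrothendieckAbelian.{w} C] (S : ObjectProperty C) :
    ASuppOf (locGen S) = ASuppOf S := by
  refine Set.Subset.antisymm ?_ (ASuppOf_mono fun X hX P _ hS => hS _ hX)
  rintro α ⟨M, hM, hα⟩
  exact hM _ (supportIn_isLocalizing.{w} (ASuppOf S)) (fun X hX β hβ => ⟨X, hX, hβ⟩) hα

theorem locGen_isLocalizing [IsGrothendieckAbelian.{w} C] (S : ObjectProperty C) :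
    IsLocalizing (locGen S) := by
  have (J : Type w) : (locGen S).IsClosedUnderColimitsOfShape (Discrete J) :=
    ⟨fun X ⟨h⟩ P hP hS => by
      have := hP.isClosedUnderColimitsOfShape (Discrete J)
      exact P.prop_of_isColimit h.isColimit fun j => h.prop_diag_obj j P hP hS⟩
  exact isLocalizing_of_closedUnderCoproducts.{w} _

theorem nextLoc_isLocalizing [IsGrothendieckAbelian.{w} C] (P : ObjectProperty C)
    [P.IsSerreClass] (hP : IsLocalizing P) : IsLocalizing (nextLoc P) := by
  obtain ⟨_, _⟩ := hP
  have := isGrothendieckAbelian_quotient.{w} P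
  have hloc : IsLocalizing (simpleLoc P.isoModSerre.Localization) := locGen_isLocalizing.{w} _
  have (J : Type w) : (nextLoc P).IsClosedUnderColimitsOfShape (Discrete J) := by
    refine ⟨fun X ⟨h⟩ => ?_⟩
    have := hloc.isClosedUnderColimitsOfShape (Discrete J)
    have : PreservesColimitsOfShape (Discrete J) P.isoModSerre.Q :=
      (Adjunction.ofIsLeftAdjoint P.isoModSerre.Q).leftAdjoint_preservesColimits.1
    exact (simpleLoc P.isoModSerre.Localization).prop_of_isColimit
      (isColimitOfPreserves P.isoModSerre.Q h.isColimit) h.prop_diag_obj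
  exact isLocalizing_of_closedUnderCoproducts.{w} _

theorem le_nextLoc (P : ObjectProperty C) [P.IsSerreClass] : P ≤ nextLoc P := fun X hX =>
  (simpleLoc P.isoModSerre.Localization).prop_of_isZero ((isZero_quotient_iff P X).2 hX)

/-- If all proper quotients of `H` lie in `P`, then the image of `H` in `C / P` is zero or
simple. -/
theorem nextLoc_of_quotients (P : ObjectProperty C) [P.IsSerreClass] {H : C}
    (h : ∀ (K : C) (i : K ⟶ H) [Mono i], ¬ IsZero K → P (cokernel i)) : nextLoc P H := by
  by_cases hH : P H
  · exact le_nextLoc P _ hH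
  refine fun R _ hR => hR _ ?_
  have hz : ¬ IsZero (P.isoModSerre.Q.obj H) := fun hz => hH ((isZero_quotient_iff P H).1 hz)
  have := Localization.essSurj P.isoModSerre.Q P.isoModSerre
  refine ⟨fun {Y} f _ => ⟨fun _ h0 => hz ?_, fun hf => ?_⟩⟩
  · subst h0
    exact IsZero.of_epi_zero Y _
  · obtain ⟨φ, hφ⟩ := Localization.exists_rightFraction P.isoModSerre.Q P.isoModSerre
      ((P.isoModSerre.Q.objObjPreimageIso Y).hom ≫ f)
    have h1 := φ.map_s_comp_map P.isoModSerre.Q (Localization.inverts _ _)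
    rw [← hφ] at h1
    have : IsIso (P.isoModSerre.Q.map φ.s) := (isIso_quotient_iff P _).2 φ.hs
    have hne : ¬ IsZero (Abelian.image φ.f) := by
      intro h0
      have : P.isoModSerre.Q.map φ.f = 0 :=
        (quotient_map_eq_zero_iff P _).2 (P.prop_of_isZero h0)
      rw [this] at h1
      exact hf (by simpa using h1)
    have hπ : P (cokernel φ.f) := by
      refine P.prop_of_epi (cokernel.desc (Abelian.image.ι φ.f) (cokernel.π φ.f) ?_)
        (h _ (Abelian.image.ι φ.f) hne)
    have hepi : Epi (P.isoModSerre.Q.map φ.f) :=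
      (ObjectProperty.SerreClassLocalization.epi_map_iff P.isoModSerre.Q P φ.f).2 hπ
    rw [← h1, ← Category.assoc] at hepi
    have : Epi f :=
      epi_of_epi (P.isoModSerre.Q.map φ.s ≫ (P.isoModSerre.Q.objObjPreimageIso Y).hom) f
    exact isIso_of_mono_of_epi f

end Support

/-! ### Noetherian objects, monoform subobjects and torsion -/

section Noetherian

variable {C : Type u} [Category.{v} C] [Abelian C]

theorem isZero_of_mono_eq_zero {X Y : C} {f : X ⟶ Y} [Mono f] (h : f = 0) : IsZero X := by
  subst h
  exact IsZero.of_mono_zero X Y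

theorem exists_maximal_quotient (X : C) [IsNoetherianObject X] (S : ObjectProperty C)
    [S.IsClosedUnderIsomorphisms] (hX : S X) :
    ∃ (R : C) (q : X ⟶ R), Epi q ∧ S R ∧ ∀ (R' : C) (r : R ⟶ R') [Epi r], S R' → Mono r := by
  have h0 : ({N : Subobject X | S (cokernel N.arrow)} : Set (Subobject X)).Nonempty := by
    refine ⟨⊥, ?_⟩
    have : (⊥ : Subobject X).arrow = 0 := Subobject.bot_arrow
    exact S.prop_of_iso ((cokernelIsoOfEq this).trans cokernelZeroIsoTarget).symm hX
  obtain ⟨N, hN, hmax⟩ := wellFounded_gt.has_min _ h0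
  refine ⟨cokernel N.arrow, cokernel.π N.arrow, inferInstance, hN, fun R' r _ hR' => ?_⟩
  let q := cokernel.π N.arrow
  let N' := kernelSubobject (q ≫ r)
  have hle : N ≤ N' := le_kernelSubobject _ _ (by simp [q])
  have hN' : S (cokernel N'.arrow) := by
    have e : N'.arrow = (kernelSubobjectIso (q ≫ r)).hom ≫ kernel.ι (q ≫ r) := by simp [N']
    exact S.prop_of_iso ((IsColimit.coconePointUniqueUpToIso
      (Abelian.epiIsCokernelOfKernel _ (limit.isLimit _)) (colimit.isColimit _)) ≪≫
        (cokernelEpiComp (kernelSubobjectIso (q ≫ r)).hom (kernel.ι (q ≫ r))).symm ≪≫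
        (cokernelIsoOfEq e).symm) hR'
  have heq : N' = N := (eq_of_le_of_not_lt hle (hmax N' hN')).symm
  have hz : kernel.ι (q ≫ r) ≫ q = 0 := by
    rw [← kernelSubobject_arrow' (q ≫ r), Category.assoc]
    have : N'.arrow ≫ q = 0 := by
      rw [heq]
      exact cokernel.condition _
    rw [this, comp_zero]
  have hs := Abelian.comp_epiDesc (q ≫ r) q hz
  rw [Category.assoc] at hs
  have hs' : r ≫ Abelian.epiDesc (q ≫ r) q hz = 𝟙 _ := by
    rw [← cancel_epi q, hs, Category.comp_id]
  exact mono_of_mono_fac hs'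

/-- Let `R` be a last quotient of `X` sharing a nonzero subobject `L` with `X`. If `L` and `L / K`
had a common nonzero subobject, then, as `L / K` embeds in `R / K`, the proper quotient `R / K`
would share one with `X` too. -/
theorem exists_isMonoform_mono (X : C) [IsNoetherianObject X] (hX : ¬ IsZero X) :
    ∃ (H : C) (j : H ⟶ X), Mono j ∧ IsMonoform H := by
  let S : ObjectProperty C := fun R => CommonNonzeroSubobject X R
  have : S.IsClosedUnderIsomorphisms :=
    ⟨fun e ⟨L, hL, hf, g, _⟩ => ⟨L, hL, hf, g ≫ e.hom, inferInstance⟩⟩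
  obtain ⟨R, q, _, ⟨L, hL, ⟨f, _⟩, ⟨g, _⟩⟩, hmax⟩ :=
    exists_maximal_quotient X S (CommonNonzeroSubobject.refl hX)
  refine ⟨L, f, inferInstance, hL, fun K k _ hK => ?_⟩
  rintro ⟨L', hL', ⟨a, _⟩, ⟨b, _⟩⟩
  have := mono_cokernel_map_comp k g
  have := hmax _ (cokernel.π (k ≫ g))
    ⟨L', hL', ⟨a ≫ f, inferInstance⟩, ⟨b ≫ cokernel.map k (k ≫ g) (𝟙 K) g (by simp), inferInstance⟩⟩
  refine hK (isZero_of_mono_eq_zero (f := k ≫ g) ?_)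
  rw [← cancel_mono (cokernel.π (k ≫ g)), cokernel.condition, zero_comp]

/-- A noetherian object outside of `P` has a quotient outside of `P` all of whose proper quotients
lie in `P`. -/
theorem exists_critical_quotient (P : ObjectProperty C) [P.IsSerreClass] (X : C)
    [IsNoetherianObject X] (hX : ¬ P X) :
    ∃ (R : C) (q : X ⟶ R), Epi q ∧ ¬ P R ∧
      ∀ (K : C) (i : K ⟶ R) [Mono i], ¬ IsZero K → P (cokernel i) := by
  let S : ObjectProperty C := fun R => ¬ P R
  have : S.IsClosedUnderIsomorphisms := ⟨fun e h h' => h (P.prop_of_iso e.symm h')⟩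
  obtain ⟨R, q, hq, hR, hmax⟩ := exists_maximal_quotient X S hX
  refine ⟨R, q, hq, hR, fun K i _ hK => ?_⟩
  by_contra hc
  have := hmax _ (cokernel.π i) hc
  refine hK (isZero_of_mono_eq_zero (f := i) ?_)
  rw [← cancel_mono (cokernel.π i), cokernel.condition, zero_comp]

theorem isNoetherianObject_of_epi {X Y : C} (p : X ⟶ Y) [Epi p] [IsNoetherianObject X] :
    IsNoetherianObject Y := by
  have hinj (N₁ N₂ : Subobject Y)
      (h : (Subobject.pullback p).obj N₁ ≤ (Subobject.pullback p).obj N₂) : N₁ ≤ N₂ := by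
    have sq := Subobject.isPullback p N₁
    have sq₂ := Subobject.isPullback p N₂
    have : Epi (Subobject.pullbackπ p N₁) := by
      rw [← sq.isoPullback_hom_fst]
      infer_instance
    have hz : N₁.arrow ≫ cokernel.π N₂.arrow = 0 := by
      rw [← cancel_epi (Subobject.pullbackπ p N₁), comp_zero, ← Category.assoc, sq.w,
        ← Subobject.ofLE_arrow h, Category.assoc, Category.assoc, ← sq₂.w_assoc,
        cokernel.condition, comp_zero, comp_zero]
    exact Subobject.le_of_comm (Abelian.monoLift N₂.arrow N₁.arrow hz) (Abelian.monoLift_comp _ _ _)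
  rw [isNoetherianObject_iff_not_strictMono]
  intro f hf
  refine not_strictMono_of_isNoetherianObject (fun n => (Subobject.pullback p).obj (f n)) ?_
  intro a b hab
  exact lt_of_le_not_ge ((Subobject.pullback p).monotone (hf hab).le)
    fun h => (hf hab).not_ge (hinj _ _ h)

theorem IsLocallyNoetherian.exists_noetherian_mono (hC : IsLocallyNoetherian.{w} C) (X : C)
    (hX : ¬ IsZero X) : ∃ (N : C) (i : N ⟶ X), Mono i ∧ IsNoetherianObject N ∧ ¬ IsZero N := by
  obtain ⟨ι, G, hG, hsep⟩ := hC
  by_contra! hno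
  refine hX ((IsZero.iff_id_eq_zero X).2 (hsep _ _ ?_))
  rintro _ ⟨k⟩ h
  have := hG k
  have := isNoetherianObject_of_epi (Abelian.factorThruImage h)
  have hz := hno _ (Abelian.image.ι h) inferInstance inferInstance
  have h0 : h = 0 := (Abelian.image.fac h).symm.trans
    (by rw [hz.eq_zero_of_src (Abelian.image.ι h), comp_zero])
  rw [h0, zero_comp, zero_comp]

theorem IsLocallyNoetherian.exists_isMonoform_mono (hC : IsLocallyNoetherian.{w} C) (X : C)
    (hX : ¬ IsZero X) :
    ∃ (H : C) (i : H ⟶ X), Mono i ∧ IsNoetherianObject H ∧ IsMonoform H := by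
  obtain ⟨N, i, _, _, hN⟩ := hC.exists_noetherian_mono X hX
  obtain ⟨H, j, _, hH⟩ := AtomDimension.exists_isMonoform_mono N hN
  exact ⟨H, j ≫ i, inferInstance, isNoetherianObject_of_mono j, hH⟩

theorem exists_mono_of_atomOf_mem_ASuppOf {P : ObjectProperty C} [P.IsSerreClass] {H : C}
    (hH : IsMonoform H) (h : atomOf H hH ∈ ASuppOf P) :
    ∃ (L : C) (j : L ⟶ H), Mono j ∧ ¬ IsZero L ∧ P L := by
  obtain ⟨M, hM, H', hH', e, hs⟩ := h
  obtain ⟨L, hL, ⟨f, _⟩, ⟨g, _⟩⟩ : CommonNonzeroSubobject H' H := Quotient.exact e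
  exact ⟨L, g, inferInstance, hL, P.prop_of_mono f (hs.prop hM)⟩

/-- The torsion part is the kernel of the adjunction unit. The quotient by it embeds in an object in
the image of the right adjoint, which receives only zero maps from `P`. -/
theorem IsLocalizing.exists_torsionFree_quotient {P : ObjectProperty C} (hP : IsLocalizing P)
    (X : C) : ∃ (K : C) (i : K ⟶ X), Mono i ∧ P K ∧
      ∀ (L : C) (j : L ⟶ cokernel i) [Mono j], P L → IsZero L := by
  obtain ⟨_, _⟩ := hP
  let adj := Adjunction.ofIsLeftAdjoint P.isoModSerre.Q
  let η : X ⟶ P.isoModSerre.Q.rightAdjoint.obj (P.isoModSerre.Q.obj X) := adj.unit.app X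
  have hη' : P.isoModSerre.Q.map η ≫ adj.counit.app (P.isoModSerre.Q.obj X) =
    𝟙 (P.isoModSerre.Q.obj X) := adj.left_triangle_components X
  have hη : Mono (P.isoModSerre.Q.map η) := mono_of_mono_fac hη'
  refine ⟨kernel η, kernel.ι η, inferInstance, ?_, fun L j _ hL => ?_⟩
  · rw [← isZero_quotient_iff P]
    refine isZero_of_mono_eq_zero (f := P.isoModSerre.Q.map (kernel.ι η)) ?_
    rw [← cancel_mono (P.isoModSerre.Q.map η), ← Functor.map_comp, kernel.condition, zero_comp,
      Functor.map_zero]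
  · have hz := (isZero_quotient_iff P L).2 hL
    refine isZero_of_mono_eq_zero (f := j ≫ Abelian.factorThruCoimage η) ?_
    exact (adj.homEquiv _ _).symm.injective (hz.eq_of_src _ _)

/-- A nonzero torsion-free quotient of `X` would contain a monoform object. Its atom lies in
`ASuppOf P`, so it would have a nonzero subobject in `P`. -/
theorem IsLocalizing.prop_of_ASupp_subset {P : ObjectProperty C} (hP : IsLocalizing P)
    (hC : IsLocallyNoetherian.{w} C) {X : C} (h : ASupp X ⊆ ASuppOf P) : P X := by
  obtain ⟨_, _⟩ := id hP
  obtain ⟨K, i, _, hK, htf⟩ := hP.exists_torsionFree_quotient X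
  by_cases hz : IsZero (cokernel i)
  · have : Epi i := Preadditive.epi_of_isZero_cokernel i hz
    exact P.prop_of_epi i hK
  · exfalso
    obtain ⟨H, j, _, _, hH⟩ := hC.exists_isMonoform_mono _ hz
    have hα : atomOf H hH ∈ ASuppOf P :=
      h (ASupp_subset_of_epi (cokernel.π i) (ASupp_subset_of_mono j (atomOf_mem_ASupp hH)))
    obtain ⟨L, l, _, hL, hPL⟩ := exists_mono_of_atomOf_mem_ASuppOf hH hα
    exact hL (htf L (l ≫ j) hPL)

/-- Applying the right adjoint and pulling back along the unit sends subobjects of `Q X` to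
subobjects of `X`. This is monotone, and injective because `Q` recovers the original subobject. -/
theorem isNoetherianObject_quotient (P : ObjectProperty C) [P.IsSerreClass]
    [P.isoModSerre.Q.IsLeftAdjoint] (X : C) [IsNoetherianObject X] :
    IsNoetherianObject (P.isoModSerre.Q.obj X) := by
  let Q := P.isoModSerre.Q
  let G := Q.rightAdjoint
  let adj : Q ⊣ G := Adjunction.ofIsLeftAdjoint Q
  have := counit_isIso_of_isLocalization P.isoModSerre adj
  have : PreservesLimitsOfSize.{0, 0} G := adj.rightAdjoint_preservesLimits
  let η : X ⟶ G.obj (Q.obj X) := adj.unit.app X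
  have hη : Q.map η ≫ adj.counit.app (Q.obj X) = 𝟙 (Q.obj X) := adj.left_triangle_components X
  have : IsIso (Q.map η) := by
    have : Q.map η = inv (adj.counit.app (Q.obj X)) := by
      rw [← cancel_mono (adj.counit.app (Q.obj X)), hη, IsIso.inv_hom_id]
    rw [this]
    infer_instance
  let φ (Y : Subobject (Q.obj X)) : Subobject X :=
    (Subobject.pullback η).obj (Subobject.mk (G.map Y.arrow))
  have hφ (Y : Subobject (Q.obj X)) : Y = Subobject.mk (Q.map (φ Y).arrow) := by
    have sq := (Subobject.isPullback η (Subobject.mk (G.map Y.arrow))).map Q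
    have : IsIso (Q.map (Subobject.pullbackπ η (Subobject.mk (G.map Y.arrow)))) := by
      rw [← sq.isoPullback_hom_fst]
      infer_instance
    let e := asIso (Q.map (Subobject.pullbackπ η (Subobject.mk (G.map Y.arrow)))) ≪≫
      Q.mapIso (Subobject.underlyingIso (G.map Y.arrow)) ≪≫ asIso (adj.counit.app (Y : _))
    have he : e.hom ≫ Y.arrow = Q.map (φ Y).arrow := by
      have h1 : Q.map (φ Y).arrow = Q.map (φ Y).arrow ≫ Q.map η ≫ adj.counit.app (Q.obj X) := by
        rw [hη, Category.comp_id]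
      have h2 : (Subobject.mk (G.map Y.arrow)).arrow =
        (Subobject.underlyingIso (G.map Y.arrow)).hom ≫ G.map Y.arrow := by simp
      rw [h1, ← Category.assoc, ← sq.w, h2, Functor.map_comp]
      simp [e]
    refine le_antisymm ?_ ?_
    · exact Subobject.le_mk_of_comm e.inv (by rw [← he, Iso.inv_hom_id_assoc])
    · exact Subobject.mk_le_of_comm e.hom he
  have hmono : Monotone φ := fun Y₁ Y₂ h => by
    refine (Subobject.pullback η).monotone ?_
    exact Subobject.mk_le_mk_of_comm (G.map (Subobject.ofLE _ _ h))
      (by rw [← Functor.map_comp, Subobject.ofLE_arrow])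
  have hinj : Function.Injective φ := fun Y₁ Y₂ h => by rw [hφ Y₁, hφ Y₂, h]
  rw [isNoetherianObject_iff_not_strictMono]
  intro f hf
  exact not_strictMono_of_isNoetherianObject (φ ∘ f) ((hmono.strictMono_of_injective hinj).comp hf)

theorem simple_of_mono {S L : C} [Simple S] (f : L ⟶ S) [Mono f] (hL : ¬ IsZero L) : Simple L := by
  have : IsIso f := isIso_of_mono_of_nonzero fun h => hL (isZero_of_mono_eq_zero h)
  exact Simple.of_iso (asIso f)

theorem simple_of_isSubquotient {S H : C} [Simple S] (h : IsSubquotient H S) (hH : ¬ IsZero H) :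
    Simple H := by
  obtain ⟨N, i, p, _, _⟩ := h
  have hN : ¬ IsZero N := fun hN => hH (IsZero.of_epi p hN)
  have := simple_of_mono i hN
  have : IsIso p := isIso_of_epi_of_nonzero fun h => hH (by subst h; exact IsZero.of_epi_zero N H)
  exact Simple.of_iso (asIso p).symm

theorem exists_simple_of_mem_ASuppOf {α : ASpec C} (h : α ∈ ASuppOf (fun X : C => Simple X)) :
    ∃ (H : C) (hH : IsMonoform H), atomOf H hH = α ∧ Simple H := by
  obtain ⟨M, hM, H, hH, e, hs⟩ := h
  have : Simple M := hM
  exact ⟨H, hH, e, simple_of_isSubquotient hs hH.1⟩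

theorem exists_simple_mono_of_simpleLoc [IsGrothendieckAbelian.{w} C] (X : C)
    [IsNoetherianObject X] (hX : ¬ IsZero X) (h : simpleLoc C X) :
    ∃ (L : C) (j : L ⟶ X), Mono j ∧ Simple L := by
  obtain ⟨Y, j, _, hY⟩ := exists_isMonoform_mono X hX
  have hα : atomOf Y hY ∈ ASuppOf (simpleLoc C) :=
    ⟨Y, (simpleLoc C).prop_of_mono j h, atomOf_mem_ASupp hY⟩
  rw [simpleLoc, ASuppOf_locGen.{w}] at hα
  obtain ⟨H, hH, e, _⟩ := exists_simple_of_mem_ASuppOf hα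
  obtain ⟨L, hL, ⟨f, _⟩, ⟨g, _⟩⟩ : CommonNonzeroSubobject H Y := Quotient.exact e
  exact ⟨L, g ≫ j, inferInstance, simple_of_mono f hL⟩

/-- A noetherian object of `nextLoc P` without nonzero subobjects in `P` has a nonzero subobject
all of whose proper quotients lie in `P`. -/
theorem exists_critical_mono [IsGrothendieckAbelian.{w} C] (P : ObjectProperty C) [P.IsSerreClass]
    (hP : IsLocalizing P) (H : C) [IsNoetherianObject H] (hH : nextLoc P H) (h0 : ¬ IsZero H)
    (htf : ∀ (L : C) (j : L ⟶ H) [Mono j], P L → IsZero L) :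
    ∃ (N : C) (i : N ⟶ H), Mono i ∧ ¬ IsZero N ∧
      ∀ (K : C) (k : K ⟶ N) [Mono k], ¬ IsZero K → P (cokernel k) := by
  obtain ⟨_, _⟩ := hP
  have := isGrothendieckAbelian_quotient.{w} P
  have := isNoetherianObject_quotient P H
  have hz : ¬ IsZero (P.isoModSerre.Q.obj H) := fun hz =>
    h0 (htf H (𝟙 H) ((isZero_quotient_iff P H).1 hz))
  obtain ⟨L, j, _, _⟩ := exists_simple_mono_of_simpleLoc.{w} _ hz hH
  have := Localization.essSurj P.isoModSerre.Q P.isoModSerre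
  let e := P.isoModSerre.Q.objObjPreimageIso L
  obtain ⟨φ, hφ⟩ := Localization.exists_rightFraction P.isoModSerre.Q P.isoModSerre (e.hom ≫ j)
  have h1 := φ.map_s_comp_map P.isoModSerre.Q (Localization.inverts _ _)
  rw [← hφ] at h1
  have : IsIso (P.isoModSerre.Q.map φ.s) := (isIso_quotient_iff P _).2 φ.hs
  have hmono : Mono (P.isoModSerre.Q.map φ.f) := by
    rw [← h1]
    infer_instance
  have h2 : P.isoModSerre.Q.map (Abelian.factorThruImage φ.f) ≫
      P.isoModSerre.Q.map (Abelian.image.ι φ.f) = P.isoModSerre.Q.map φ.f := by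
    rw [← Functor.map_comp, Abelian.image.fac]
  have : Mono (P.isoModSerre.Q.map (Abelian.factorThruImage φ.f)) := mono_of_mono_fac h2
  have : IsIso (P.isoModSerre.Q.map (Abelian.factorThruImage φ.f)) := isIso_of_mono_of_epi _
  have hS : Simple (P.isoModSerre.Q.obj (Abelian.image φ.f)) :=
    Simple.of_iso ((asIso (P.isoModSerre.Q.map (Abelian.factorThruImage φ.f))).symm ≪≫
      asIso (P.isoModSerre.Q.map φ.s) ≪≫ e)
  -- This image becomes simple in the quotient. A nonzero subobject `K` of it is not in `P`, so it
  -- becomes the whole simple object, which puts the cokernel in `P`.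
  refine ⟨Abelian.image φ.f, Abelian.image.ι φ.f, inferInstance, fun hz => ?_, fun K k _ hK => ?_⟩
  · exact Simple.not_isZero _ (P.isoModSerre.Q.map_isZero hz)
  · have hne : P.isoModSerre.Q.map k ≠ 0 := fun h => hK
      (htf K (k ≫ Abelian.image.ι φ.f) ((isZero_quotient_iff P K).1 (isZero_of_mono_eq_zero h)))
    have hiso : IsIso (P.isoModSerre.Q.map k) := isIso_of_mono_of_nonzero hne
    exact ((isIso_quotient_iff P k).1 hiso).2

end Noetherian

/-! ### The Gabriel–Krull filtration and chains of atoms -/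

section Filtration

variable {C : Type u} [Category.{v} C] [Abelian C]

instance gkFiltration_isSerreClass (σ : WithBot Ordinal.{w}) :
    (gkFiltration C σ).IsSerreClass := by
  induction σ using WithBot.recBotCoe with
  | bot => exact inferInstanceAs (ObjectProperty.IsSerreClass IsZero)
  | coe σ => exact (gkFiltrationAux C σ).2

theorem gkFiltration_zero : gkFiltration C ((0 : Ordinal.{w}) : WithBot Ordinal.{w}) =
    simpleLoc C := by
  change (gkFiltrationAux C 0).1 = _
  rw [gkFiltrationAux, Ordinal.limitRecOn_zero]

theorem gkFiltration_add_one (σ : Ordinal.{w}) :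
    gkFiltration C ((σ + 1 : Ordinal.{w}) : WithBot Ordinal.{w}) =
      nextLoc (gkFiltration C (σ : WithBot Ordinal.{w})) := by
  change (gkFiltrationAux C (σ + 1)).1 = _
  rw [gkFiltrationAux, Ordinal.limitRecOn_add_one]
  rfl

theorem gkFiltration_limit (σ : Ordinal.{w}) (h : Order.IsSuccLimit σ) :
    gkFiltration C (σ : WithBot Ordinal.{w}) =
      locGen (fun X => ∃ ρ < σ, gkFiltration C (ρ : WithBot Ordinal.{w}) X) := by
  refine (congrArg Subtype.val (Ordinal.limitRecOn_limit _ _ _ _ h)).trans ?_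
  change locGen _ = locGen _
  congr 1
  ext X
  exact ⟨fun ⟨ρ, h, hX⟩ => ⟨ρ, h, hX⟩, fun ⟨ρ, h, hX⟩ => ⟨ρ, h, hX⟩⟩

theorem gkFiltration_isLocalizing [IsGrothendieckAbelian.{w} C] (σ : WithBot Ordinal.{w}) :
    IsLocalizing (gkFiltration C σ) := by
  induction σ using WithBot.recBotCoe with
  | bot =>
    have (J : Type w) :
        ObjectProperty.IsClosedUnderColimitsOfShape (IsZero (C := C)) (Discrete J) :=
      ⟨fun X ⟨h⟩ => (IsZero.iff_id_eq_zero X).2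
        (h.isColimit.hom_ext fun j => (h.prop_diag_obj j).eq_of_src _ _)⟩
    exact isLocalizing_of_closedUnderCoproducts.{w} (IsZero (C := C))
  | coe σ =>
    induction σ using Ordinal.limitRecOn with
    | zero =>
      rw [gkFiltration_zero]
      exact locGen_isLocalizing.{w} _
    | add_one σ ih =>
      rw [gkFiltration_add_one]
      exact nextLoc_isLocalizing.{w} _ ih
    | limit σ h _ =>
      rw [gkFiltration_limit σ h]
      exact locGen_isLocalizing.{w} _

theorem gkFiltration_mono : Monotone (gkFiltration.{w} C) := by
  have key (σ : Ordinal.{w}) : ∀ ρ ≤ σ, gkFiltration C (ρ : WithBot Ordinal.{w}) ≤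
      gkFiltration C (σ : WithBot Ordinal.{w}) := by
    induction σ using Ordinal.limitRecOn with
    | zero =>
      intro ρ hρ
      rw [nonpos_iff_eq_zero.1 hρ]
    | add_one σ ih =>
      intro ρ hρ
      rcases hρ.lt_or_eq with h | rfl
      · rw [gkFiltration_add_one]
        exact (ih ρ (Order.lt_add_one_iff.1 h)).trans (le_nextLoc _)
      · exact le_rfl
    | limit σ h _ =>
      intro ρ hρ
      rcases hρ.lt_or_eq with h' | rfl
      · rw [gkFiltration_limit σ h]
        exact fun X hX P _ hS => hS _ ⟨ρ, h', hX⟩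
      · exact le_rfl
  intro ρ σ h
  induction ρ using WithBot.recBotCoe with
  | bot => exact fun X hX => (gkFiltration C σ).prop_of_isZero hX
  | coe ρ =>
    induction σ using WithBot.recBotCoe with
    | bot => simp at h
    | coe σ => exact key σ ρ (WithBot.coe_le_coe.1 h)

theorem succ_coe_eq (σ : Ordinal.{w}) :
    Order.succ (σ : WithBot Ordinal.{w}) = ((σ + 1 : Ordinal.{w}) : WithBot Ordinal.{w}) := by
  rw [WithBot.orderSucc_coe, Order.succ_eq_add_one]

theorem succ_bot_eq :
    Order.succ (⊥ : WithBot Ordinal.{w}) = ((0 : Ordinal.{w}) : WithBot Ordinal.{w}) := by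
  rw [WithBot.orderSucc_bot, Ordinal.bot_eq_zero]

/-- All proper quotients of `H` lie in `P`. -/
def HasProperQuotientsIn (P : ObjectProperty C) (H : C) : Prop :=
  ∀ (K : C) (i : K ⟶ H) [Mono i], ¬ IsZero K → P (cokernel i)

/-- Modulo `C_σ` such an object is zero or simple. Level `-1` is treated apart because `C_0` is
defined in `C` itself, not in a quotient category. -/
theorem HasProperQuotientsIn.gkFiltration_succ {σ : WithBot Ordinal.{w}} {H : C}
    (h : HasProperQuotientsIn (gkFiltration C σ) H) : gkFiltration C (Order.succ σ) H := by
  induction σ using WithBot.recBotCoe with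
  | bot =>
    rw [succ_bot_eq, gkFiltration_zero]
    by_cases hH : IsZero H
    · exact (simpleLoc C).prop_of_isZero hH
    · refine fun P _ hP => hP _ ⟨fun {Y} f _ => ⟨fun _ h0 => hH ?_, fun hf => ?_⟩⟩
      · subst h0
        exact IsZero.of_epi_zero Y _
      · have hz := h Y f fun hz => hf (hz.eq_zero_of_src f)
        have := Preadditive.epi_of_isZero_cokernel f hz
        exact isIso_of_mono_of_epi f
  | coe σ =>
    rw [succ_coe_eq, gkFiltration_add_one]
    exact nextLoc_of_quotients _ h

theorem isOpen_ASupp (M : C) : IsOpen (ASupp M) := by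
  rintro α ⟨H, hH, e, N, i, p, _, _⟩
  exact ⟨H, hH, e, (ASupp_subset_of_epi p).trans (ASupp_subset_of_mono i)⟩

theorem isOpen_ASuppOf (P : ObjectProperty C) : IsOpen (ASuppOf P) := by
  rintro α ⟨M, hM, hα⟩
  obtain ⟨H, hH, e, h⟩ := isOpen_ASupp M α hα
  exact ⟨H, hH, e, fun β hβ => ⟨M, hM, h hβ⟩⟩

/-- A monoform subquotient `N / ker p` is either a subobject of `H`, with the same atom, or a
subobject of the proper quotient `H / ker p`, which lies in `P`. -/
theorem HasProperQuotientsIn.ASupp_subset {P : ObjectProperty C} [P.IsSerreClass] {H : C}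
    (hH : IsMonoform H) (h : HasProperQuotientsIn P H) {β : ASpec C} (hβ : β ∈ ASupp H) :
    β = atomOf H hH ∨ β ∈ ASuppOf P := by
  obtain ⟨H', hH', rfl, N, i, p, _, _⟩ := hβ
  by_cases hz : IsZero (kernel p)
  · left
    have : Mono p := Preadditive.mono_of_isZero_kernel p hz
    have : IsIso p := isIso_of_mono_of_epi p
    exact Quotient.sound ⟨H', hH'.1, ⟨𝟙 H', inferInstance⟩, ⟨inv p ≫ i, inferInstance⟩⟩
  · right
    have := mono_cokernel_map_comp (kernel.ι p) i
    have h1 : P (cokernel (kernel.ι p)) := P.prop_of_mono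
      (cokernel.map (kernel.ι p) (kernel.ι p ≫ i) (𝟙 _) i _) (h _ (kernel.ι p ≫ i) hz)
    have : Epi (cokernel.desc (kernel.ι p) p (kernel.condition p)) :=
      epi_of_epi_fac (cokernel.π_desc _ _ _)
    exact ⟨H', P.prop_of_epi (cokernel.desc (kernel.ι p) p (kernel.condition p)) h1,
      atomOf_mem_ASupp hH'⟩

theorem ASuppOf_gkFiltration_bot : ASuppOf (gkFiltration.{w} C ⊥) = ∅ := by
  refine Set.eq_empty_of_forall_notMem ?_
  rintro α ⟨M, hM, hα⟩
  rw [ASupp_eq_empty_of_isZero hM] at hα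
  exact hα

theorem HasAtomChain.le_of_gkFiltration {M : C} {κ : Ordinal.{w}} (h : HasAtomChain M κ)
    {σ : WithBot Ordinal.{w}} (hσ : gkFiltration C σ M) : (κ : WithBot Ordinal.{w}) ≤ σ := by
  obtain ⟨a, -, haM, κ₁, hκ₁, -, ha⟩ := h
  rw [hκ₁, Order.succ_le_iff]
  by_contra hle
  exact ha ⟨M, gkFiltration_mono (not_lt.1 hle) _ hσ, haM _⟩

variable [IsGrothendieckAbelian.{w} C]

/-- An atom in the support of the filtration first appears at a successor of an element of
`{-1} ∪ Ord`. -/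
theorem exists_succ_of_mem_ASuppOf {α : ASpec C} {σ : WithBot Ordinal.{w}}
    (h : α ∈ ASuppOf (gkFiltration C σ)) :
    ∃ ρ < σ, α ∈ ASuppOf (gkFiltration C (Order.succ ρ)) ∧ α ∉ ASuppOf (gkFiltration C ρ) := by
  let S : Set (WithBot Ordinal.{w}) := {τ | α ∈ ASuppOf (gkFiltration C τ)}
  obtain ⟨τ, hτ, hmin⟩ := wellFounded_lt.has_min S ⟨σ, h⟩
  have hmin' (ρ : WithBot Ordinal.{w}) (hρ : ρ < τ) : α ∉ ASuppOf (gkFiltration C ρ) :=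
    fun hα => hmin ρ hα hρ
  have hle : τ ≤ σ := not_lt.1 (hmin σ h)
  suffices ∃ ρ, τ = Order.succ ρ by
    obtain ⟨ρ, rfl⟩ := this
    exact ⟨ρ, Order.succ_le_iff.1 hle, hτ, hmin' ρ (Order.lt_succ ρ)⟩
  have hα : α ∈ ASuppOf (gkFiltration C τ) := hτ
  clear hτ hmin hle
  induction τ using WithBot.recBotCoe with
  | bot =>
    rw [ASuppOf_gkFiltration_bot] at hα
    exact absurd hα (Set.notMem_empty α)
  | coe τ =>
    induction τ using Ordinal.limitRecOn with
    | zero => exact ⟨⊥, succ_bot_eq.symm⟩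
    | add_one τ _ => exact ⟨τ, (succ_coe_eq τ).symm⟩
    | limit τ hlim _ =>
      -- No atom is new at a limit level.
      rw [gkFiltration_limit τ hlim, ASuppOf_locGen.{w}] at hα
      obtain ⟨M, ⟨ρ, hρ, hM⟩, hαM⟩ := hα
      exact absurd ⟨M, hM, hαM⟩ (hmin' ρ (WithBot.coe_lt_coe.2 hρ))

/-- At `-1` a simple representative works. Otherwise a noetherian representative in `C_{ρ+1}` has no
nonzero subobject in `C_ρ`, since `α` is new, and `exists_critical_mono` applies. -/
theorem exists_hasProperQuotientsIn (hC : IsLocallyNoetherian.{w} C) {α : ASpec C}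
    {ρ : WithBot Ordinal.{w}} (h : α ∈ ASuppOf (gkFiltration C (Order.succ ρ)))
    (h' : α ∉ ASuppOf (gkFiltration C ρ)) :
    ∃ (H : C) (hH : IsMonoform H), atomOf H hH = α ∧
      HasProperQuotientsIn (gkFiltration C ρ) H := by
  induction ρ using WithBot.recBotCoe with
  | bot =>
    rw [succ_bot_eq, gkFiltration_zero, simpleLoc, ASuppOf_locGen.{w}] at h
    obtain ⟨H, hH, e, _⟩ := exists_simple_of_mem_ASuppOf h
    refine ⟨H, hH, e, fun K i _ hK => ?_⟩
    have : IsIso i := isIso_of_mono_of_nonzero fun h => hK (isZero_of_mono_eq_zero h)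
    exact isZero_cokernel_of_epi i
  | coe ρ =>
    rw [succ_coe_eq, gkFiltration_add_one] at h
    revert h h'
    refine Quotient.inductionOn α ?_
    rintro ⟨H₀, hH₀⟩ h h'
    obtain ⟨L, j, _, hL, hPL⟩ := exists_mono_of_atomOf_mem_ASuppOf hH₀ h
    obtain ⟨N, i, _, _, hN⟩ := hC.exists_noetherian_mono L hL
    have hNm := hH₀.of_mono (i ≫ j) hN
    have eN : atomOf N hNm = atomOf H₀ hH₀ := atomOf_eq_of_mono hH₀ (i ≫ j) hN
    have htf (T : C) (t : T ⟶ N) [Mono t] (hT : gkFiltration C (ρ : WithBot Ordinal.{w}) T) :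
        IsZero T := by
      by_contra hz
      refine h' ⟨T, hT, ?_⟩
      change atomOf H₀ hH₀ ∈ _
      rw [← eN, ← atomOf_eq_of_mono hNm t hz]
      exact atomOf_mem_ASupp _
    obtain ⟨K, k, _, hK, hq⟩ := exists_critical_mono.{w} _ (gkFiltration_isLocalizing _) N
      ((nextLoc _).prop_of_mono i hPL) hN htf
    exact ⟨K, hNm.of_mono k hK, (atomOf_eq_of_mono hNm k hK).trans eN, hq⟩

/-- The critical representative of `α` has an open support, which therefore contains `β`, and which
consists of `α` and atoms of `C_ρ`. -/
theorem mem_ASuppOf_of_lt (hC : IsLocallyNoetherian.{w} C) {α β : ASpec C}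
    {ρ : WithBot Ordinal.{w}} (h : α ∈ ASuppOf (gkFiltration C (Order.succ ρ)))
    (h' : α ∉ ASuppOf (gkFiltration C ρ)) (hαβ : α < β) : β ∈ ASuppOf (gkFiltration C ρ) := by
  obtain ⟨H, hH, rfl, hq⟩ := exists_hasProperQuotientsIn hC h h'
  rcases hq.ASupp_subset hH (hαβ.le _ (isOpen_ASupp H) (atomOf_mem_ASupp hH)) with rfl | h
  · exact absurd hαβ (lt_irrefl _)
  · exact h

/-- The union of the filtration is a Serre subcategory. Otherwise `X` has a quotient `R` outside it
with all proper quotients inside. As `R` has a small set of subobjects, one level `τ` contains all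
these quotients, so `R` lies in `C_{τ+1}`. -/
theorem exists_gkFiltration_of_noetherian (X : C) [IsNoetherianObject X] :
    ∃ σ : WithBot Ordinal.{w}, gkFiltration C σ X := by
  let P : ObjectProperty C := fun X => ∃ σ : WithBot Ordinal.{w}, gkFiltration C σ X
  have : P.IsSerreClass :=
    { exists_zero := ⟨_, isZero_zero C, ⊥, isZero_zero C⟩
      prop_of_mono := fun f _ ⟨σ, h⟩ => ⟨σ, (gkFiltration C σ).prop_of_mono f h⟩
      prop_of_epi := fun f _ ⟨σ, h⟩ => ⟨σ, (gkFiltration C σ).prop_of_epi f h⟩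
      prop_X₂_of_shortExact := fun hS ⟨σ, h⟩ ⟨τ, h'⟩ => ⟨max σ τ,
        (gkFiltration C (max σ τ)).prop_X₂_of_shortExact hS
          (gkFiltration_mono (le_max_left σ τ) _ h) (gkFiltration_mono (le_max_right σ τ) _ h')⟩ }
  by_contra hX
  obtain ⟨R, q, _, hR, hq⟩ := exists_critical_quotient P X hX
  have hord (K : Subobject R) :
      ∃ σ : Ordinal.{w}, ¬ IsZero (K : C) → gkFiltration C (σ : WithBot Ordinal.{w})
        (cokernel K.arrow) := by
    by_cases hK : IsZero (K : C)
    · exact ⟨0, fun h => absurd hK h⟩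
    · obtain ⟨σ, hσ⟩ := hq _ K.arrow hK
      -- Raising a level `-1` to `0` is harmless and keeps the bounds in the ordinals, where small
      -- families have suprema.
      exact ⟨σ.unbotD 0, fun _ => gkFiltration_mono (WithBot.le_coe_unbotD _ _) _ hσ⟩
  choose o ho using hord
  obtain ⟨τ, hτ⟩ : BddAbove (Set.range o) := Ordinal.bddAbove_of_small
  refine hR ⟨Order.succ (τ : WithBot Ordinal.{w}), HasProperQuotientsIn.gkFiltration_succ ?_⟩
  intro K i _ hK
  have hK' : ¬ IsZero ((Subobject.mk i : Subobject R) : C) := fun h =>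
    hK (h.of_iso (Subobject.underlyingIso i).symm)
  have h1 := gkFiltration_mono (WithBot.coe_le_coe.2 (hτ ⟨Subobject.mk i, rfl⟩)) _ (ho _ hK')
  refine (gkFiltration C _).prop_of_iso (?_ : cokernel (Subobject.mk i).arrow ≅ _) h1
  exact cokernelIsoOfEq (Subobject.underlyingIso_hom_comp_eq_mk i).symm ≪≫ cokernelEpiComp _ _

theorem exists_mem_ASuppOf (hC : IsLocallyNoetherian.{w} C) (α : ASpec C) :
    ∃ σ : WithBot Ordinal.{w}, α ∈ ASuppOf (gkFiltration C σ) := by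
  refine Quotient.inductionOn α ?_
  rintro ⟨H, hH⟩
  obtain ⟨N, i, _, _, hN⟩ := hC.exists_noetherian_mono H hH.1
  obtain ⟨σ, hσ⟩ := exists_gkFiltration_of_noetherian.{w} N
  refine ⟨σ, N, hσ, ?_⟩
  change atomOf H hH ∈ _
  rw [← atomOf_eq_of_mono hH i hN]
  exact atomOf_mem_ASupp _

theorem ASpec_eq_of_le_of_le (hC : IsLocallyNoetherian.{w} C) {α β : ASpec C} (h : α ≤ β)
    (h' : β ≤ α) : α = β := by
  obtain ⟨σ, hσ⟩ := exists_mem_ASuppOf hC α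
  obtain ⟨ρ, -, h₁, h₂⟩ := exists_succ_of_mem_ASuppOf hσ
  obtain ⟨H, hH, rfl, hq⟩ := exists_hasProperQuotientsIn hC h₁ h₂
  rcases hq.ASupp_subset hH (h _ (isOpen_ASupp H) (atomOf_mem_ASupp hH)) with rfl | h
  · rfl
  · exact absurd (h' _ (isOpen_ASuppOf _) h) h₂

/-- A critical quotient `R` of a noetherian representative with support in `{β | α ≤ β}` has an atom
outside `ASupp C_ρ`. By hypothesis this atom is not strictly above `α`, so it is `α`, and `R` lies
in `C_{ρ+1}`. -/
theorem mem_ASuppOf_succ_of_forall_lt (hC : IsLocallyNoetherian.{w} C)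
    [AlexandrovDiscrete (ASpec C)] {α : ASpec C} {ρ : WithBot Ordinal.{w}}
    (hα : α ∉ ASuppOf (gkFiltration C ρ)) (h : ∀ β, α < β → β ∈ ASuppOf (gkFiltration C ρ)) :
    α ∈ ASuppOf (gkFiltration C (Order.succ ρ)) := by
  -- This intersection is `{β | α ≤ β}`; the Alexandroff hypothesis enters only here.
  have hopen : IsOpen (⋂₀ {Φ : Set (ASpec C) | IsOpen Φ ∧ α ∈ Φ}) :=
    AlexandrovDiscrete.isOpen_sInter _ fun Φ hΦ => hΦ.1
  obtain ⟨H, hH, rfl, hs⟩ := hopen α fun Φ hΦ => hΦ.2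
  obtain ⟨N, i, _, _, hN⟩ := hC.exists_noetherian_mono H hH.1
  have hNP : ¬ gkFiltration C ρ N := fun hNP => hα
    ⟨N, hNP, by
      rw [← atomOf_eq_of_mono hH i hN]
      exact atomOf_mem_ASupp _⟩
  obtain ⟨R, q, _, hR, hq⟩ := exists_critical_quotient (gkFiltration C ρ) N hNP
  obtain ⟨β, hβ, hβ'⟩ : ∃ β ∈ ASupp R, β ∉ ASuppOf (gkFiltration C ρ) := by
    by_contra! hno
    exact hR ((gkFiltration_isLocalizing ρ).prop_of_ASupp_subset hC hno)
  have hle : atomOf H hH ≤ β := fun Φ hΦ hαΦ =>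
    hs (ASupp_subset_of_mono i (ASupp_subset_of_epi q hβ)) Φ ⟨hΦ, hαΦ⟩
  have hge : β ≤ atomOf H hH := by
    by_contra hge
    exact hβ' (h β ⟨hle, hge⟩)
  rw [ASpec_eq_of_le_of_le hC hle hge]
  exact ⟨R, HasProperQuotientsIn.gkFiltration_succ hq, hβ⟩

/-- The elements `-1, 0, 1, ...` of `{-1} ∪ Ord`. -/
noncomputable def shiftedNat : ℕ → WithBot Ordinal.{w}
  | 0 => ⊥
  | n + 1 => ((n : Ordinal.{w}) : WithBot Ordinal.{w})


theorem succ_shiftedNat (n : ℕ) : Order.succ (shiftedNat.{w} n) = shiftedNat (n + 1) := by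
  cases n with
  | zero => simp [shiftedNat]
  | succ n => simp [shiftedNat]

/-- Since `shiftedNat (n + 1)` is the ordinal `n`, the hypotheses say that `α` is new at level `n`.
Only the first `n` steps of `f` matter. -/
theorem exists_chain (hC : IsLocallyNoetherian.{w} C) [AlexandrovDiscrete (ASpec C)] (n : ℕ)
    (α : ASpec C) (h : α ∈ ASuppOf (gkFiltration C (shiftedNat.{w} (n + 1))))
    (h' : α ∉ ASuppOf (gkFiltration C (shiftedNat.{w} n))) :
    ∃ f : ℕ → ASpec C, f 0 = α ∧ ∀ i < n, f i < f (i + 1) := by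
  induction n generalizing α with
  | zero => exact ⟨fun _ => α, rfl, fun i hi => absurd hi (Nat.not_lt_zero _)⟩
  | succ n ih =>
    -- If all larger atoms lay this low, `α` would appear one level earlier. By `mem_ASuppOf_of_lt`,
    -- `β` is then new exactly one level below `α`.
    obtain ⟨β, hαβ, hβ⟩ : ∃ β, α < β ∧ β ∉ ASuppOf (gkFiltration C (shiftedNat.{w} n)) := by
      by_contra! hno
      refine h' ?_
      rw [← succ_shiftedNat]
      refine mem_ASuppOf_succ_of_forall_lt hC (fun h0 => h' ?_) hno
      rw [← succ_shiftedNat]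
      exact ASuppOf_mono (gkFiltration_mono (Order.le_succ _)) h0
    rw [← succ_shiftedNat] at h
    obtain ⟨g, rfl, hg⟩ := ih β (mem_ASuppOf_of_lt hC h h' hαβ) hβ
    refine ⟨fun i => Nat.casesOn i α g, rfl, fun i hi => ?_⟩
    cases i with
    | zero => exact hαβ
    | succ i => exact hg i (Nat.lt_of_succ_lt_succ hi)

/-- At a term of lowest level, the next term would have a still lower one. -/
theorem not_strictMono_nat (hC : IsLocallyNoetherian.{w} C) (f : ℕ → ASpec C) :
    ¬ StrictMono f := by
  intro hf
  let S : Set (WithBot Ordinal.{w}) := {σ | ∃ n, f n ∈ ASuppOf (gkFiltration C σ)}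
  obtain ⟨σ, hσ⟩ := exists_mem_ASuppOf hC (f 0)
  obtain ⟨τ, ⟨n, hn⟩, hmin⟩ := wellFounded_lt.has_min S ⟨σ, 0, hσ⟩
  obtain ⟨ρ, hρ, h₁, h₂⟩ := exists_succ_of_mem_ASuppOf hn
  exact hmin ρ ⟨n + 1, mem_ASuppOf_of_lt hC h₁ h₂ (hf (Nat.lt_succ_self n))⟩ hρ

theorem HasAtomChain.exists_nat_eq (hC : IsLocallyNoetherian.{w} C) {M : C} {κ : Ordinal.{w}}
    (h : HasAtomChain M κ) : ∃ n : ℕ, κ = n := by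
  obtain ⟨a, ha, -⟩ := h
  refine Ordinal.lt_omega0.1 (not_le.1 fun hκ => ?_)
  refine not_strictMono_nat hC (fun n : ℕ => a ⟨(n : Ordinal.{w}),
    (Ordinal.natCast_lt_omega0 n).le.trans hκ⟩) fun m n hmn => ha ?_
  exact Subtype.mk_lt_mk.2 (by exact_mod_cast hmn)

theorem hasAtomChain_of_mem (hC : IsLocallyNoetherian.{w} C) [AlexandrovDiscrete (ASpec C)]
    {M : C} {n : ℕ} {α : ASpec C} (hM : α ∈ ASupp M)
    (h : α ∈ ASuppOf (gkFiltration C (shiftedNat.{w} (n + 1))))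
    (h' : α ∉ ASuppOf (gkFiltration C (shiftedNat.{w} n))) :
    HasAtomChain M (n : Ordinal.{w}) := by
  obtain ⟨f, rfl, hf⟩ := exists_chain hC n α h h'
  have hlt : ∀ i j : ℕ, i < j → j ≤ n → f i < f j := by
    intro i j hij
    induction j, hij using Nat.le_induction with
    | base => exact fun hj => hf i hj
    | succ j _ ih => exact fun hj => (ih (by omega)).trans (hf j hj)
  have hnat (i : Set.Iic (n : Ordinal.{w})) : ∃ k : ℕ, (i : Ordinal.{w}) = k :=
    Ordinal.lt_omega0.1 (lt_of_le_of_lt i.2 (Ordinal.natCast_lt_omega0 n))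
  choose k hk using hnat
  have hkn (i) : k i ≤ n := by
    have := i.2
    rw [Set.mem_Iic, hk i] at this
    exact_mod_cast this
  have hk0 (hz : (0 : Ordinal.{w}) ∈ Set.Iic (n : Ordinal.{w})) : k ⟨0, hz⟩ = 0 := by
    have h0 : (0 : Ordinal.{w}) = (k ⟨0, hz⟩ : ℕ) := hk ⟨0, hz⟩
    exact_mod_cast h0.symm
  refine ⟨fun i => f (k i), fun i j hij => ?_, fun i => ?_, shiftedNat n, ?_, ?_, ?_⟩
  · refine hlt _ _ ?_ (hkn j)
    have : (i : Ordinal.{w}) < j := hij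
    rw [hk i, hk j] at this
    exact_mod_cast this
  · rcases Nat.eq_zero_or_pos (k i) with h0 | h0
    · change f (k i) ∈ _
      rwa [h0]
    -- Supports are open, hence closed upwards, so the chain stays in `ASupp M`.
    · exact (hlt 0 (k i) h0 (hkn i)).le _ (isOpen_ASupp M) hM
  · exact (succ_shiftedNat n).symm
  · change f (k _) ∈ _
    rwa [hk0]
  · change f (k _) ∉ _
    rwa [hk0]

theorem gkFiltration_of_isDim (hC : IsLocallyNoetherian.{w} C) [AlexandrovDiscrete (ASpec C)]
    {M : C} {κ : Ordinal.{w}} (hκ : IsDim M κ) :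
    gkFiltration C (κ : WithBot Ordinal.{w}) M := by
  by_contra hM
  obtain ⟨n, rfl⟩ := hκ.1.exists_nat_eq hC
  have hn : ((n : Ordinal.{w}) : WithBot Ordinal.{w}) = shiftedNat (n + 1) := rfl
  rw [hn] at hM
  obtain ⟨α, hα, hα'⟩ :
      ∃ α ∈ ASupp M, α ∉ ASuppOf (gkFiltration C (shiftedNat.{w} (n + 1))) := by
    by_contra! hno
    exact hM ((gkFiltration_isLocalizing _).prop_of_ASupp_subset hC hno)
  -- Minimality of the level of `β` forces every larger atom, which is again in `ASupp M` and of
  -- lower level, into `ASupp C_n`. So `β` is new at level `n + 1`.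
  let S : Set (WithBot Ordinal.{w}) := {σ | ∃ β ∈ ASupp M,
    β ∉ ASuppOf (gkFiltration C (shiftedNat.{w} (n + 1))) ∧ β ∈ ASuppOf (gkFiltration C σ)}
  obtain ⟨σ, hσ⟩ := exists_mem_ASuppOf hC α
  obtain ⟨τ, ⟨β, hβM, hβ, hβτ⟩, hmin⟩ := wellFounded_lt.has_min S ⟨σ, α, hα, hα', hσ⟩
  obtain ⟨ρ, hρ, h₁, h₂⟩ := exists_succ_of_mem_ASuppOf hβτ
  have hsucc : β ∈ ASuppOf (gkFiltration C (shiftedNat.{w} (n + 1 + 1))) := by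
    rw [← succ_shiftedNat]
    refine mem_ASuppOf_succ_of_forall_lt hC hβ fun γ hγ => ?_
    by_contra hγ'
    exact hmin ρ ⟨γ, hγ.le _ (isOpen_ASupp M) hβM, hγ', mem_ASuppOf_of_lt hC h₁ h₂ hγ⟩ hρ
  have hle := hκ.2 (hasAtomChain_of_mem hC hβM hsucc hβ)
  have : n + 1 ≤ n := by exact_mod_cast hle
  omega

end Filtration
end AtomDimension

theorem theorem4 {C : Type u} [Category.{v} C] [Abelian C] [IsGrothendieckAbelian.{w} C]
    (M : C) (κ : Ordinal.{w}) (hκ : IsDim M κ) :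
    (∀ σ : WithBot Ordinal.{w}, IsGKDim M σ → (κ : WithBot Ordinal.{w}) ≤ σ) ∧
    (IsLocallyNoetherian.{w} C → AlexandrovDiscrete (ASpec C) →
      IsGKDim M (κ : WithBot Ordinal.{w})) :=
  ⟨fun _ hσ => hκ.1.le_of_gkFiltration hσ.1, fun hC _ =>
    ⟨gkFiltration_of_isDim hC hκ, fun _ hσ => hκ.1.le_of_gkFiltration hσ⟩⟩
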